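/- We work in synthetic differential geometry: "space" means an object of a sheaf topos $\mathrm{Sh}(\mathcal C,J)$ on an arbitrary site, and all notions and quantifiers below are understood in the internal (Kripke--Joyal) sense. Let $R$ be a commutative ring object which is a $\mathbb Q$-algebra and satisfies the Kock--Lawvere axiom for all $$D_k(n)=\{d\in R^n : \text{every product of } k+1 \text{ coordinates of } d \text{ vanishes}\},\qquad k,n\ge 1,$$ i.e. every map $D_k(n)\to R$ is given by a unique polynomial over $R$ of total degree $\le k$. **Manifolds.** A subspace $U\subseteq F$ of a space $F$ is *formally open* if for all $k,m\ge1$ every map $t:D_k(m)\to F$ with $t(0)\in U$ has all its values in $U$. A *chart* of a space $A$ is a formally open subspace $U\subseteq A$ together with an embedding of $U$ onto a formally open subspace of some $R^N$. $A$ is a *formal manifold* if each point of $A$ lies in a chart. **i-structures.** An *i-structure* on $A$ is a family of subspaces $A\langle n\rangle\subseteq A^n$, $n\in\mathbb N$, with $A\langle 0\rangle=A^0$, $A\langle1\rangle=A$, and $(P_{h(1)},\dots,P_{h(m)})\in A\langle m\rangle$ for each $(P_1,\dots,P_n)\in A\langle n\rangle$ and each map $h:\{1,\dots,m\}\to\{1,\dots,n\}$.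 For $k\geq 1$ the $k$th-order i-structure of $R^N$ consists of the tuples $(P_1,\dots,P_m)$ such that for all $i_\ell\ne j_\ell$ ($1\le \ell\le k+1$) the vectors $v_\ell=P_{i_\ell}-P_{j_\ell}$ lie in $D_k(N)$ and $\phi(v_1,\dots,v_{k+1})=0$ for every $(k+1)$-linear form $\phi$ on $R^N$ (no condition if $m\le1$). On a formal manifold $A$, the $k$th-order i-structure $A_k$ consists of the tuples that lie in some chart and whose coordinates form a tuple of the $k$th-order i-structure of $R^N$. One writes $\langle P_1,\dots,P_m\rangle$ for a tuple in the i-structure. **i-affine structures.** Put $\mathcal A(n)=\{\mu\in R^n:\sum_j\mu_j=1\}$. An *i-affine structure* on an i-structure $A\langle-\rangle$ consists of maps $\mathcal A(n)\times A\langle n\rangle\to A$, $(\mu,\langle P_1,\dots,P_n\rangle)\mapsto\mu\cdot\langle P_1,\dots,P_n\rangle$, for $n\ge1$, such that, for $\langle P_1,\dots,P_n\rangle\in A\langle n\rangle$, $\nu^1,\dots,\nu^m\in\mathcal A(n)$ and $\mu\in\mathcal A(m)$: the points $Q_k=\nu^k\cdot\langle P_1,\dots,P_n\rangle$ satisfy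 $(Q_1,\dots,Q_m)\in A\langle m\rangle$ (neighbourhood); $\mu\cdot\langle Q_1,\dots,Q_m\rangle=\bigl(\sum_k\mu_k\nu^k\bigr)\cdot\langle P_1,\dots,P_n\rangle$ if $m\geq 1$ (associativity); and $e_k\cdot\langle P_1,\dots,P_n\rangle=P_k$ for each standard basis vector $e_k$ (projection). **Connections.** A *symmetric affine connection* $\lambda$ on a formal manifold $A$ is a map assigning to all $P,Q,S\in A$ with $\langle P,Q\rangle,\langle P,S\rangle\in A_1\langle2\rangle$ a point $\lambda(P,Q,S)\in A$ such that $\lambda(P,Q,P)=Q$, $\lambda(P,P,S)=S$ and $\lambda(P,Q,S)=\lambda(P,S,Q)$. **Theorem.** Let $\lambda$ be a symmetric affine connection on a formal manifold $A$. Then there is an i-affine structure on $A_2$ such that, whenever $\langle P,Q\rangle,\langle P,S\rangle\in A_1\langle2\rangle$, one has $\langle P,Q,S\rangle\in A_2\langle3\rangle$ and $$\lambda(P,Q,S)=(-1,1,1)\cdot\langle P,Q,S\rangle .$$ Moreover, in each chart $U$ of $A$, with embedding into $R^N$, it is given by the Christoffel symbols of $\lambda$: there is exactly one map $\Gamma$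 from $U$ to the symmetric bilinear maps $R^N\times R^N\to R^N$ such that, for all $P\in U$ and all first-order neighbours $Q,S$ of $P$ (that is, $\langle P,Q\rangle,\langle P,S\rangle\in A_1\langle2\rangle$), the points $Q$, $S$, $\lambda(P,Q,S)$ lie in $U$ and, in coordinates, $$\lambda(P,Q,S)=Q+S-P+\Gamma_P[Q-P,S-P];$$ and for all $n\ge1$, $\mu\in\mathcal A(n)$ and $\langle P_1,\dots,P_n\rangle\in A_2\langle n\rangle$ with all $P_j\in U$, the point $\mu\cdot\langle P_1,\dots,P_n\rangle$ lies in $U$ and, in coordinates, $$\mu\cdot\langle P_1,\dots,P_n\rangle=\sum_{j=1}^n\mu_jP_j+\tfrac12\Bigl(\Gamma_{P_1}\bigl[\textstyle\sum_{j}\mu_jP_j-P_1\bigr]^2-\sum_{j=1}^n\mu_j\,\Gamma_{P_1}[P_j-P_1]^2\Bigr),$$ where $\Gamma_{P_1}[v]^2=\Gamma_{P_1}[v,v]$. -/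

import Mathlib

/-!
Synthetic differential geometry has no classical set-theoretic models, so "spaces" are the objects
of a sheaf topos `Sh(C, J)`, and every notion is written out in the internal logic of that topos
(Kripke-Joyal semantics): an element of `F` at stage `c` is an element of `F.obj (op c)`, universal
quantifiers and implications range over all later stages `f : d ⟶ c`, and existential quantifiers
are witnessed on a covering sieve.
-/

open CategoryTheory Opposite

universe u v w

namespace InfAff

variable {C : Type u} [Category.{v} C]

/-! ### The line `R`, the spaces `R ^ n` and the infinitesimal spaces `D_k(n)` -/

/-- Restriction of scalars (elements of `R`) along `f : d ⟶ c`. -/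
def res (R : Cᵒᵖ ⥤ CommAlgCat.{w} ℚ) {c d : C} (f : d ⟶ c) :
    R.obj (op c) →ₐ[ℚ] R.obj (op d) :=
  (R.map f.op).hom

/-- Restriction of vectors along `f : d ⟶ c`. -/
def resVec (R : Cᵒᵖ ⥤ CommAlgCat.{w} ℚ) {c d : C} (f : d ⟶ c) {n : ℕ}
    (x : Fin n → R.obj (op c)) : Fin n → R.obj (op d) :=
  fun i => res R f (x i)

/-- The space underlying the ring object `R`. -/
def line (R : Cᵒᵖ ⥤ CommAlgCat.{w} ℚ) : Cᵒᵖ ⥤ Type w where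
  obj c := R.obj c
  map f := TypeCat.ofHom fun x => (R.map f).hom x

/-- The space `R ^ n`. -/
def affSpace (R : Cᵒᵖ ⥤ CommAlgCat.{w} ℚ) (n : ℕ) : Cᵒᵖ ⥤ Type w where
  obj c := Fin n → R.obj c
  map f := TypeCat.ofHom fun x i => (R.map f).hom (x i)

/-- `D_k(n)`: the vectors `x` in `R ^ n` such that every product of `k + 1` coordinates of `x`
(repetitions allowed) vanishes. -/
def D (R : Cᵒᵖ ⥤ CommAlgCat.{w} ℚ) (k n : ℕ) : Subfunctor (affSpace R n) where
  obj c := {x : Fin n → R.obj c | ∀ s : Fin (k + 1) → Fin n, ∏ i, x (s i) = 0}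
  map {c d} f := by
    intro x hx s
    have h := congrArg (R.map f).hom (hx s)
    rw [map_prod, map_zero] at h
    exact h

/-- The base point `0` of `D_k(n)`. -/
def D.zero (R : Cᵒᵖ ⥤ CommAlgCat.{w} ℚ) (k n : ℕ) (c : C) :
    (D R k n).toFunctor.obj (op c) :=
  ⟨fun _ => 0, fun s => by simp⟩

/-- A map `F → G` defined at stage `c`, i.e. an element at stage `c` of the function space. -/
@[ext]
structure StageMap (F G : Cᵒᵖ ⥤ Type w) (c : C) where
  app : ∀ ⦃d : C⦄, (d ⟶ c) → F.obj (op d) → G.obj (op d)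
  naturality : ∀ ⦃d e : C⦄ (f : d ⟶ c) (g : e ⟶ d) (x : F.obj (op d)),
    G.map g.op (app f x) = app (g ≫ f) (F.map g.op x)

/-- `R` is a (commutative) `ℚ`-algebra object of `Sh(C, J)` which satisfies the Kock-Lawvere axiom
for all `D_k(n)` with `k, n ≥ 1`: every map `D_k(n) → R` is given by a unique polynomial over `R`
of total degree at most `k`. -/
structure IsKockLawvere (J : GrothendieckTopology C) (R : Cᵒᵖ ⥤ CommAlgCat.{w} ℚ) : Prop where
  isSheaf : Presieve.IsSheaf J (line R)
  kockLawvere : ∀ k n : ℕ, 1 ≤ k → 1 ≤ n → ∀ (c : C) (t : StageMap (D R k n).toFunctor (line R) c),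
    ∃! p : MvPolynomial (Fin n) (R.obj (op c)), p.totalDegree ≤ k ∧
      ∀ (d : C) (f : d ⟶ c) (x : (D R k n).toFunctor.obj (op d)),
        t.app f x = MvPolynomial.eval₂ (res R f : R.obj (op c) →+* R.obj (op d)) x.1 p

/-! ### Formally open subspaces, charts, formal manifolds -/

/-- A subspace `U` of `F`, given at stage `c`, is formally open if it is stable under infinitesimal
perturbations: every map `t : D_k(m) → F` with `t 0` in `U` takes all its values in `U`. (For a
subspace this says that its inclusion is formally étale.) -/
def IsFormallyOpen (R : Cᵒᵖ ⥤ CommAlgCat.{w} ℚ) (F : Cᵒᵖ ⥤ Type w) {c : C}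
    (U : ∀ ⦃d : C⦄, (d ⟶ c) → Set (F.obj (op d))) : Prop :=
  ∀ k m : ℕ, 1 ≤ k → 1 ≤ m → ∀ (d : C) (f : d ⟶ c) (t : StageMap (D R k m).toFunctor F d),
    t.app (𝟙 d) (D.zero R k m d) ∈ U f →
      ∀ (e : C) (g : e ⟶ d) (x : (D R k m).toFunctor.obj (op e)), t.app g x ∈ U (g ≫ f)

/-- A chart of `A` at stage `c`: a formally open subspace `mem` of `A` together with an embedding
`coord` onto a formally open subspace of some `R ^ dim`. -/
structure Chart (J : GrothendieckTopology C) (R : Cᵒᵖ ⥤ CommAlgCat.{w} ℚ) (A : Cᵒᵖ ⥤ Type w)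
    (c : C) where
  mem : ∀ ⦃d : C⦄, (d ⟶ c) → Set (A.obj (op d))
  mem_map : ∀ ⦃d e : C⦄ (f : d ⟶ c) (g : e ⟶ d) (P : A.obj (op d)),
    P ∈ mem f → A.map g.op P ∈ mem (g ≫ f)
  mem_of_cover : ∀ ⦃d : C⦄ (f : d ⟶ c) (P : A.obj (op d)) (S : Sieve d), S ∈ J d →
    (∀ ⦃e : C⦄ (g : e ⟶ d), S g → A.map g.op P ∈ mem (g ≫ f)) → P ∈ mem f
  dim : ℕ
  coord : ∀ ⦃d : C⦄ (f : d ⟶ c) (P : A.obj (op d)), P ∈ mem f → Fin dim → R.obj (op d)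
  coord_map : ∀ ⦃d e : C⦄ (f : d ⟶ c) (g : e ⟶ d) (P : A.obj (op d)) (hP : P ∈ mem f),
    coord (g ≫ f) (A.map g.op P) (mem_map f g P hP) = resVec R g (coord f P hP)
  coord_injective : ∀ ⦃d : C⦄ (f : d ⟶ c) (P Q : A.obj (op d)) (hP : P ∈ mem f) (hQ : Q ∈ mem f),
    coord f P hP = coord f Q hQ → P = Q
  isFormallyOpen : IsFormallyOpen R A mem
  isFormallyOpen_image : IsFormallyOpen R (affSpace R dim)
    (fun d f => {x : Fin dim → R.obj (op d) | ∃ (P : A.obj (op d)) (hP : P ∈ mem f),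
      coord f P hP = x})

/-- A formal manifold: a space in which every point lies in a chart. -/
structure IsFormalManifold (J : GrothendieckTopology C) (R : Cᵒᵖ ⥤ CommAlgCat.{w} ℚ)
    (A : Cᵒᵖ ⥤ Type w) : Prop where
  isSheaf : Presieve.IsSheaf J A
  exists_chart : ∀ (c : C) (P : A.obj (op c)), ∃ S ∈ J c, ∀ ⦃d : C⦄ (f : d ⟶ c), S f →
    ∃ φ : Chart J R A d, A.map f.op P ∈ φ.mem (𝟙 d)

/-! ### i-structures -/

/-- An i-structure on the space `A`; `rel n` is the subspace of `A ^ n` of the i-`n`-tuples. -/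
structure IStructure (J : GrothendieckTopology C) (A : Cᵒᵖ ⥤ Type w) where
  rel : ∀ (n : ℕ) {c : C}, Set (Fin n → A.obj (op c))
  rel_map : ∀ (n : ℕ) ⦃c d : C⦄ (f : d ⟶ c) (P : Fin n → A.obj (op c)),
    P ∈ rel n → (fun i => A.map f.op (P i)) ∈ rel n
  rel_of_cover : ∀ (n : ℕ) ⦃c : C⦄ (P : Fin n → A.obj (op c)) (S : Sieve c), S ∈ J c →
    (∀ ⦃d : C⦄ (f : d ⟶ c), S f → (fun i => A.map f.op (P i)) ∈ rel n) → P ∈ rel n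
  rel_zero : ∀ (c : C) (P : Fin 0 → A.obj (op c)), P ∈ rel 0
  rel_one : ∀ (c : C) (P : Fin 1 → A.obj (op c)), P ∈ rel 1
  reindex : ∀ (m n : ℕ) (h : Fin m → Fin n) ⦃c : C⦄ (P : Fin n → A.obj (op c)),
    P ∈ rel n → (fun i => P (h i)) ∈ rel m

/-- `DN_k(V)` for `V = R ^ n`: the `(k+1)`-tuples of elements of `D_k(V)` on which all
`(k+1)`-linear forms vanish. -/
def DN (R : Cᵒᵖ ⥤ CommAlgCat.{w} ℚ) (k n : ℕ) (c : C) :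
    Set (Fin (k + 1) → Fin n → R.obj (op c)) :=
  {x | (∀ i, x i ∈ (D R k n).obj (op c)) ∧
    ∀ (d : C) (f : d ⟶ c)
      (ψ : MultilinearMap (R.obj (op d)) (fun _ : Fin (k + 1) => Fin n → R.obj (op d))
        (R.obj (op d))),
      ψ (fun i => resVec R f (x i)) = 0}

/-- The `k`th-order i-structure of `R ^ n`: the i-`m`-tuples. For `m ≤ 1` the condition is
void. -/
def kthRel (R : Cᵒᵖ ⥤ CommAlgCat.{w} ℚ) (k n m : ℕ) (c : C) :
    Set (Fin m → Fin n → R.obj (op c)) :=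
  {x | ∀ i j : Fin (k + 1) → Fin m, (∀ l, i l ≠ j l) →
    (fun l => x (i l) - x (j l)) ∈ DN R k n c}

/-- The i-tuples of the `k`th-order i-structures `U_k` of the charts `U` of `A` at stage `c`: tuples
which lie in a chart and whose coordinates form an i-tuple of the `k`th-order i-structure of
`R ^ dim`. -/
def IsChartTuple (J : GrothendieckTopology C) (R : Cᵒᵖ ⥤ CommAlgCat.{w} ℚ) (A : Cᵒᵖ ⥤ Type w)
    (k m : ℕ) {c : C} (P : Fin m → A.obj (op c)) : Prop :=
  ∃ (φ : Chart J R A c) (hP : ∀ i, P i ∈ φ.mem (𝟙 c)),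
    (fun i => φ.coord (𝟙 c) (P i) (hP i)) ∈ kthRel R k φ.dim m c

/-- The `k`th-order i-structure of a formal manifold: the tuples which are locally i-tuples of a
chart, i.e. the join of the images of the `U_k⟨m⟩` over all charts `U`. -/
def IsKthTuple (J : GrothendieckTopology C) (R : Cᵒᵖ ⥤ CommAlgCat.{w} ℚ) (A : Cᵒᵖ ⥤ Type w)
    (k m : ℕ) {c : C} : Set (Fin m → A.obj (op c)) :=
  {P | ∃ S ∈ J c, ∀ ⦃d : C⦄ (f : d ⟶ c), S f → IsChartTuple J R A k m fun i => A.map f.op (P i)}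

theorem zero_mem_D (R : Cᵒᵖ ⥤ CommAlgCat.{w} ℚ) (k n : ℕ) (c : C) :
    (0 : Fin n → R.obj (op c)) ∈ (D R k n).obj (op c) :=
  fun s => by simp

theorem kthRel_reindex (R : Cᵒᵖ ⥤ CommAlgCat.{w} ℚ) (k n m m' : ℕ) (c : C)
    (h : Fin m' → Fin m) (x : Fin m → Fin n → R.obj (op c)) (hx : x ∈ kthRel R k n m c) :
    (fun i => x (h i)) ∈ kthRel R k n m' c := by
  intro i j _
  by_cases hh : ∀ l, h (i l) ≠ h (j l)
  · exact hx (fun l => h (i l)) (fun l => h (j l)) hh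
  · push Not at hh
    obtain ⟨l₀, hl₀⟩ := hh
    refine ⟨fun l => ?_, fun d f ψ => ?_⟩
    · by_cases hl : h (i l) = h (j l)
      · have : x (h (i l)) - x (h (j l)) = 0 := by rw [hl, sub_self]
        change x (h (i l)) - x (h (j l)) ∈ _
        rw [this]
        exact zero_mem_D R k n c
      · exact (hx (fun _ => h (i l)) (fun _ => h (j l)) (fun _ => hl)).1 0
    · refine ψ.map_coord_zero l₀ ?_
      funext a
      simp [resVec, hl₀]

theorem kthRel_subsingleton (R : Cᵒᵖ ⥤ CommAlgCat.{w} ℚ) (k n m : ℕ) (c : C) (hm : m ≤ 1)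
    (x : Fin m → Fin n → R.obj (op c)) : x ∈ kthRel R k n m c := by
  intro i j hij
  have h := hij 0
  exact absurd (Fin.ext (by omega)) h

/-- The empty subspace is a chart. -/
def emptyChart (J : GrothendieckTopology C) (R : Cᵒᵖ ⥤ CommAlgCat.{w} ℚ) (A : Cᵒᵖ ⥤ Type w)
    (hA : Presieve.IsSheaf J A) (c : C) : Chart J R A c where
  mem d _ := {_P | (⊥ : Sieve d) ∈ J d}
  mem_map d e _ g _ hP := by
    have h := J.pullback_stable g hP
    rwa [Sieve.pullback_bot] at h
  mem_of_cover d f P S hS h := by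
    refine J.transitive hS ⊥ fun e g hg => ?_
    rw [Sieve.pullback_bot]
    exact h g hg
  dim := 0
  coord _ _ _ _ := Fin.elim0
  coord_map _ _ _ _ _ _ := funext fun i => i.elim0
  coord_injective d f P Q hP _ _ :=
    (hA ⊥ hP).isSeparatedFor.ext fun _ _ h => h.elim
  isFormallyOpen k m _ _ d f t h e g x := by
    have h := J.pullback_stable g h
    rwa [Sieve.pullback_bot] at h
  isFormallyOpen_image k m _ _ d f t h e g x := by
    obtain ⟨P, hP, _⟩ := h
    have h := J.pullback_stable g hP
    rw [Sieve.pullback_bot] at h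
    exact ⟨A.map g.op P, h, funext fun i => i.elim0⟩

/-- The `k`th-order i-structure `A_k` of a formal manifold `A`. -/
def kthIStructure {J : GrothendieckTopology C} {R : Cᵒᵖ ⥤ CommAlgCat.{w} ℚ} {A : Cᵒᵖ ⥤ Type w}
    (hA : IsFormalManifold J R A) (k : ℕ) : IStructure J A where
  rel n _ := IsKthTuple J R A k n
  rel_map n c d f P := by
    rintro ⟨S, hS, h⟩
    refine ⟨S.pullback f, J.pullback_stable f hS, fun e g hg => ?_⟩
    have key : (fun i => A.map g.op (A.map f.op (P i))) = fun i => A.map (g ≫ f).op (P i) :=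
      funext fun i => by simp
    rw [key]
    exact h (g ≫ f) hg
  rel_of_cover n c P S hS h := by
    choose T hT hT' using h
    refine ⟨Sieve.bind S.arrows fun d f hf => T f hf, ?_, ?_⟩
    · exact J.bind_covering hS fun d f hf => hT f hf
    · rintro e _ ⟨d, g, f, hf, hg, rfl⟩
      have key : (fun i => A.map (g ≫ f).op (P i)) = fun i => A.map g.op (A.map f.op (P i)) :=
        funext fun i => by simp
      rw [key]
      exact hT' f hf g hg
  rel_zero c P := by
    refine ⟨⊤, J.top_mem c, fun d f _ => ⟨emptyChart J R A hA.isSheaf d, fun i => i.elim0, ?_⟩⟩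
    exact kthRel_subsingleton R k _ 0 d (by omega) _
  rel_one c P := by
    obtain ⟨S, hS, h⟩ := hA.exists_chart c (P 0)
    refine ⟨S, hS, fun d f hf => ?_⟩
    obtain ⟨φ, hφ⟩ := h f hf
    refine ⟨φ, fun i => ?_, kthRel_subsingleton R k _ 1 d le_rfl _⟩
    rw [Subsingleton.elim i 0]
    exact hφ
  reindex m n h c P := by
    rintro ⟨S, hS, hP⟩
    refine ⟨S, hS, fun d f hf => ?_⟩
    obtain ⟨φ, hφ, hr⟩ := hP f hf
    exact ⟨φ, fun i => hφ (h i), kthRel_reindex R k _ n m d h _ hr⟩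

/-! ### i-affine structures -/

/-- Restriction along `f` sends affine weights to affine weights. -/
theorem sum_resVec {R : Cᵒᵖ ⥤ CommAlgCat.{w} ℚ} {c d : C} (f : d ⟶ c) {n : ℕ}
    {μ : Fin n → R.obj (op c)} (hμ : ∑ i, μ i = 1) : ∑ i, resVec R f μ i = 1 := by
  simp only [resVec, ← map_sum, hμ, map_one]

/-- The composite of affine weights consists of affine weights. -/
theorem sum_comp_weights {S : Type*} [CommRing S] {m n : ℕ} {μ : Fin m → S}
    {ν : Fin m → Fin n → S} (hμ : ∑ k, μ k = 1) (hν : ∀ k, ∑ j, ν k j = 1) :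
    ∑ j, ∑ k, μ k * ν k j = 1 := by
  rw [Finset.sum_comm]
  simp only [← Finset.mul_sum, hν, mul_one, hμ]

/-- An i-affine structure over `R` on an i-structure `T` of the space `A`: an action of affine
combinations on the i-tuples. `comb n` is the operation of arity `n + 1`. -/
structure IAffineStructure {J : GrothendieckTopology C} (R : Cᵒᵖ ⥤ CommAlgCat.{w} ℚ)
    {A : Cᵒᵖ ⥤ Type w} (T : IStructure J A) where
  comb : ∀ (n : ℕ) ⦃c : C⦄ (μ : Fin (n + 1) → R.obj (op c)) (P : Fin (n + 1) → A.obj (op c)),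
    ∑ j, μ j = 1 → P ∈ T.rel (n + 1) → A.obj (op c)
  comb_map : ∀ (n : ℕ) ⦃c d : C⦄ (f : d ⟶ c) (μ : Fin (n + 1) → R.obj (op c))
    (P : Fin (n + 1) → A.obj (op c)) (hμ : ∑ j, μ j = 1) (hP : P ∈ T.rel (n + 1)),
    A.map f.op (comb n μ P hμ hP) =
      comb n (resVec R f μ) (fun i => A.map f.op (P i)) (sum_resVec f hμ) (T.rel_map _ f P hP)
  neighbourhood : ∀ (m n : ℕ) ⦃c : C⦄ (ν : Fin m → Fin (n + 1) → R.obj (op c))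
    (P : Fin (n + 1) → A.obj (op c)) (hν : ∀ k, ∑ j, ν k j = 1)
    (hP : P ∈ T.rel (n + 1)),
    (fun k => comb n (ν k) P (hν k) hP) ∈ T.rel m
  associativity : ∀ (m n : ℕ) ⦃c : C⦄ (μ : Fin (m + 1) → R.obj (op c))
    (ν : Fin (m + 1) → Fin (n + 1) → R.obj (op c))
    (P : Fin (n + 1) → A.obj (op c))
    (hμ : ∑ k, μ k = 1) (hν : ∀ k, ∑ j, ν k j = 1) (hP : P ∈ T.rel (n + 1)),
    comb m μ (fun k => comb n (ν k) P (hν k) hP) hμ (neighbourhood (m + 1) n ν P hν hP) =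
      comb n (fun j => ∑ k, μ k * ν k j) P (sum_comp_weights hμ hν) hP
  projection : ∀ (n : ℕ) ⦃c : C⦄ (k : Fin (n + 1)) (P : Fin (n + 1) → A.obj (op c))
    (hP : P ∈ T.rel (n + 1)),
    comb n (Pi.single k 1) P (by simp) hP = P k

/-! ### Affine connections on points and their Christoffel symbols -/

/-- `P` and `Q` are first-order neighbours, i.e. `⟨P, Q⟩` is in `A_1⟨2⟩`. -/
def FirstNbr (J : GrothendieckTopology C) (R : Cᵒᵖ ⥤ CommAlgCat.{w} ℚ) (A : Cᵒᵖ ⥤ Type w)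
    ⦃c : C⦄ (P Q : A.obj (op c)) : Prop :=
  ![P, Q] ∈ IsKthTuple J R A 1 2

theorem FirstNbr.map {J : GrothendieckTopology C} {R : Cᵒᵖ ⥤ CommAlgCat.{w} ℚ}
    {A : Cᵒᵖ ⥤ Type w} (hA : IsFormalManifold J R A) {c d : C} (f : d ⟶ c) {P Q : A.obj (op c)}
    (h : FirstNbr J R A P Q) : FirstNbr J R A (A.map f.op P) (A.map f.op Q) := by
  have := (kthIStructure hA 1).rel_map 2 f _ h
  have e : (fun i => A.map f.op (![P, Q] i)) = ![A.map f.op P, A.map f.op Q] := by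
    funext i; fin_cases i <;> rfl
  rw [e] at this
  exact this

/-- A symmetric affine connection (on points) on the formal manifold `A`. -/
structure SymmetricConnection {J : GrothendieckTopology C} {R : Cᵒᵖ ⥤ CommAlgCat.{w} ℚ}
    {A : Cᵒᵖ ⥤ Type w} (hA : IsFormalManifold J R A) where
  app : ∀ ⦃c : C⦄ (P Q S : A.obj (op c)), FirstNbr J R A P Q → FirstNbr J R A P S → A.obj (op c)
  app_map : ∀ ⦃c d : C⦄ (f : d ⟶ c) (P Q S : A.obj (op c)) (hQ : FirstNbr J R A P Q)
    (hS : FirstNbr J R A P S), A.map f.op (app P Q S hQ hS) =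
      app (A.map f.op P) (A.map f.op Q) (A.map f.op S) (hQ.map hA f) (hS.map hA f)
  app_right : ∀ ⦃c : C⦄ (P Q : A.obj (op c)) (hQ : FirstNbr J R A P Q)
    (hP : FirstNbr J R A P P), app P Q P hQ hP = Q
  app_left : ∀ ⦃c : C⦄ (P S : A.obj (op c)) (hP : FirstNbr J R A P P)
    (hS : FirstNbr J R A P S), app P P S hP hS = S
  symm : ∀ ⦃c : C⦄ (P Q S : A.obj (op c)) (hQ : FirstNbr J R A P Q)
    (hS : FirstNbr J R A P S), app P Q S hQ hS = app P S Q hS hQ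

/-- A map assigning to each point `P` of the chart `φ` a symmetric bilinear map
`R ^ dim × R ^ dim → R ^ dim`. -/
@[ext]
structure SymBilinField {J : GrothendieckTopology C} {R : Cᵒᵖ ⥤ CommAlgCat.{w} ℚ}
    {A : Cᵒᵖ ⥤ Type w} {c : C} (φ : Chart J R A c) where
  app : ∀ ⦃d : C⦄ (f : d ⟶ c) (P : A.obj (op d)), P ∈ φ.mem f →
    (Fin φ.dim → R.obj (op d)) →ₗ[R.obj (op d)] (Fin φ.dim → R.obj (op d)) →ₗ[R.obj (op d)]
      (Fin φ.dim → R.obj (op d))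
  symm : ∀ ⦃d : C⦄ (f : d ⟶ c) (P : A.obj (op d)) (hP : P ∈ φ.mem f)
    (x y : Fin φ.dim → R.obj (op d)), app f P hP x y = app f P hP y x
  app_map : ∀ ⦃d e : C⦄ (f : d ⟶ c) (g : e ⟶ d) (P : A.obj (op d)) (hP : P ∈ φ.mem f)
    (x y : Fin φ.dim → R.obj (op d)),
    resVec R g (app f P hP x y) =
      app (g ≫ f) (A.map g.op P) (φ.mem_map f g P hP) (resVec R g x) (resVec R g y)

/-- `Γ` is the field of Christoffel symbols of the connection `L` in the chart `φ`: in the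
coordinates of `φ` one has `L(P,Q,S) = Q + S - P + Γ_P[Q - P, S - P]`. -/
def IsChristoffel {J : GrothendieckTopology C} {R : Cᵒᵖ ⥤ CommAlgCat.{w} ℚ}
    {A : Cᵒᵖ ⥤ Type w} {hA : IsFormalManifold J R A} (L : SymmetricConnection hA) {c : C}
    (φ : Chart J R A c) (Γ : SymBilinField φ) : Prop :=
  ∀ (d : C) (f : d ⟶ c) (P Q S : A.obj (op d)) (hPQ : FirstNbr J R A P Q)
    (hPS : FirstNbr J R A P S) (hP : P ∈ φ.mem f),
    ∃ (hQ : Q ∈ φ.mem f) (hS : S ∈ φ.mem f) (hL : L.app P Q S hPQ hPS ∈ φ.mem f),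
      φ.coord f (L.app P Q S hPQ hPS) hL =
        φ.coord f Q hQ + φ.coord f S hS - φ.coord f P hP +
          Γ.app f P hP (φ.coord f Q hQ - φ.coord f P hP) (φ.coord f S hS - φ.coord f P hP)

/-- In the chart `φ` the affine combinations of `α` are given by
`μ · ⟨P_0,…,P_n⟩ = ∑ μ_j P_j + 1/2 (Γ_{P_0}[∑ μ_j P_j - P_0]^2 - ∑ μ_j Γ_{P_0}[P_j - P_0]^2)`. -/
def IsGivenBy {J : GrothendieckTopology C} {R : Cᵒᵖ ⥤ CommAlgCat.{w} ℚ}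
    {A : Cᵒᵖ ⥤ Type w} {T : IStructure J A} (α : IAffineStructure R T) {c : C}
    (φ : Chart J R A c) (Γ : SymBilinField φ) : Prop :=
  ∀ (n : ℕ) (d : C) (f : d ⟶ c) (μ : Fin (n + 1) → R.obj (op d)) (P : Fin (n + 1) → A.obj (op d))
    (hμ : ∑ j, μ j = 1) (hP : P ∈ T.rel (n + 1)) (hφ : ∀ j, P j ∈ φ.mem f),
    ∃ hα : α.comb n μ P hμ hP ∈ φ.mem f,
      φ.coord f (α.comb n μ P hμ hP) hα =
        ∑ j, μ j • φ.coord f (P j) (hφ j) +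
          (2⁻¹ : ℚ) •
            (Γ.app f (P 0) (hφ 0)
                (∑ j, μ j • φ.coord f (P j) (hφ j) - φ.coord f (P 0) (hφ 0))
                (∑ j, μ j • φ.coord f (P j) (hφ j) - φ.coord f (P 0) (hφ 0)) -
              ∑ j, μ j • Γ.app f (P 0) (hφ 0)
                (φ.coord f (P j) (hφ j) - φ.coord f (P 0) (hφ 0))
                (φ.coord f (P j) (hφ j) - φ.coord f (P 0) (hφ 0)))

end InfAff

/-!
The second-order i-structure is flat in suitable coordinates: in a chart, at a point `P`, the map
`ℓ(v) = v - 1/2 Γ_P[v]^2` is invertible modulo terms of third order, and the prescribed formula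
says that affine combinations are formed by transporting the affine structure of `R ^ N` along
`ℓ`. All displacements in a second-order tuple have coordinates in an ideal `I` (`nbrIdeal`) with
`I ^ 3 = 0`, so the identities needed are identities of polynomials of degree two.

* By the Kock-Lawvere axiom, maps on `D_1(n)` are affine (`exists_affine`) and maps on `D_2(n)` are
  quadratic (`exists_quadratic`). As charts are formally open, a change of charts around a point
  is defined on the infinitesimal neighbourhoods of that point, hence it has the form
  `y + A v + B[v]^2` on second-order neighbours (`Chart.exists_quadratic_transition`), and i-tuples
  can be recognized in any chart around their first point (`IsKthTuple.exists_coord`).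
* For fixed `P` and `S` the map `Q ↦ L(P, Q, S)` stays in the chart, since it sends `P` to `S`. It
  is affine, with coefficients which are affine in `S`; the axioms of a connection leave only a
  symmetric bilinear term free, the Christoffel symbols (`exists_isCoeff`). They are unique, as
  (bi)linear maps are determined by their values on `D_1(n)`. Comparing `L(P, Q, S)` in two charts
  gives `A Γ(u, v) + B(u, v) + B(v, u) = Γ'(A u, A v)` (`IsCoeff.transform`).
* This law makes the formula for affine combinations independent of the chart
  (`affComb_transform`), so that combinations formed locally glue to a point of `A`
  (`exists_isComb`). The formula is also independent of its base point, because
  `Γ_P[z - b]^2` differs from `Γ_P[z]^2` by an affine function of `z` (`affComb_eq_base`), and `Γ`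
  itself changes only modulo `I` between points of a tuple (`IsCoeff.bil_eq_of_near`). This gives
  associativity (`affComb_assoc`).
-/

namespace InfAff

/-! ### Linear algebra over an ideal of cube zero -/

section Algebra

variable {S : Type*} [CommRing S]

/-- The linear map `S ^ n → M` with values `A i` on the standard basis. -/
def lin {M : Type*} [AddCommGroup M] [Module S M] {n : ℕ} (A : Fin n → M) :
    (Fin n → S) →ₗ[S] M :=
  Fintype.linearCombination S A

/-- The bilinear map `S ^ n × S ^ n → M` with values `G i j` on the standard basis. -/
def bil {M : Type*} [AddCommGroup M] [Module S M] {n : ℕ} (G : Fin n → Fin n → M) :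
    (Fin n → S) →ₗ[S] (Fin n → S) →ₗ[S] M :=
  lin fun i => lin (G i)

theorem lin_apply {M : Type*} [AddCommGroup M] [Module S M] {n : ℕ} (A : Fin n → M)
    (u : Fin n → S) : lin A u = ∑ i, u i • A i := rfl

theorem bil_apply {M : Type*} [AddCommGroup M] [Module S M] {n : ℕ} (G : Fin n → Fin n → M)
    (u v : Fin n → S) : bil G u v = ∑ i, u i • ∑ j, v j • G i j := by
  simp [bil, lin, Fintype.linearCombination_apply, LinearMap.sum_apply]

theorem bil_swap {M : Type*} [AddCommGroup M] [Module S M] {n : ℕ}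
    (G : Fin n → Fin n → M) (u v : Fin n → S) : bil (fun i j => G j i) u v = bil G v u := by
  simp only [bil_apply, Finset.smul_sum]
  rw [Finset.sum_comm]
  refine Finset.sum_congr rfl fun i _ => Finset.sum_congr rfl fun j _ => ?_
  rw [smul_smul, smul_smul, mul_comm]

theorem bil_symm {M : Type*} [AddCommGroup M] [Module S M] {n : ℕ} {G : Fin n → Fin n → M}
    (hG : ∀ i j, G i j = G j i) (u v : Fin n → S) : bil G u v = bil G v u :=
  (congrArg (fun F => bil F u v) (funext₂ hG)).trans (bil_swap G u v)

theorem bil_of_bilinear {M : Type*} [AddCommGroup M] [Module S M] {n : ℕ}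
    (β : (Fin n → S) →ₗ[S] (Fin n → S) →ₗ[S] M) :
    bil (fun i j => β (Pi.single i 1) (Pi.single j 1)) = β := by
  unfold bil lin
  refine LinearMap.pi_ext' fun i => LinearMap.ext_ring ?_
  refine LinearMap.pi_ext' fun j => LinearMap.ext_ring ?_
  simp

theorem linear_apply_mem {n m : ℕ} (I : Ideal S) (f : (Fin n → S) →ₗ[S] (Fin m → S))
    {u : Fin n → S} (hu : ∀ i, u i ∈ I) (k : Fin m) : f u k ∈ I := by
  rw [LinearMap.pi_apply_eq_sum_univ f u, Finset.sum_apply]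
  exact sum_mem fun i _ => I.mul_mem_right _ (hu i)

theorem bilinear_apply_mem_mul {n m : ℕ} {I J : Ideal S}
    (β : (Fin n → S) →ₗ[S] (Fin n → S) →ₗ[S] (Fin m → S))
    {u v : Fin n → S} (hu : ∀ i, u i ∈ I) (hv : ∀ i, v i ∈ J) (k : Fin m) :
    β u v k ∈ I * J := by
  rw [LinearMap.pi_apply_eq_sum_univ β u, LinearMap.sum_apply, Finset.sum_apply]
  exact sum_mem fun i _ => Ideal.mul_mem_mul (hu i) (linear_apply_mem J (β _) hv k)

/-- Bilinear maps vanish on `I × I ^ 2` when `I ^ 3 = 0`. -/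
theorem bilinear_apply_eq_zero {n m : ℕ} {I : Ideal S} (hI : I ^ 3 = ⊥)
    (β : (Fin n → S) →ₗ[S] (Fin n → S) →ₗ[S] (Fin m → S))
    {u v : Fin n → S} (hu : ∀ i, u i ∈ I) (hv : ∀ i, v i ∈ I * I) :
    β u v = 0 ∧ β v u = 0 := by
  constructor <;> funext k
  · have h := bilinear_apply_mem_mul β hu hv k
    rwa [show I * (I * I) = I ^ 3 by ring, hI] at h
  · have h := bilinear_apply_mem_mul β hv hu k
    rwa [show I * I * I = I ^ 3 by ring, hI] at h

/-- The square of a bilinear map on `I` does not see a perturbation in `I ^ 2` when `I ^ 3 = 0`. -/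
theorem bilinear_sq_add {n m : ℕ} {I : Ideal S} (hI : I ^ 3 = ⊥)
    (β : (Fin n → S) →ₗ[S] (Fin n → S) →ₗ[S] (Fin m → S))
    {u v : Fin n → S} (hu : ∀ i, u i ∈ I) (hv : ∀ i, v i ∈ I * I) :
    β (u + v) (u + v) = β u u := by
  have h1 := bilinear_apply_eq_zero hI β hu hv
  have h2 := bilinear_apply_eq_zero hI β (fun i => Ideal.mul_le_right (hv i)) hv
  simp [h1.1, h1.2, h2.1]

theorem sum_smul_sub_base {M : Type*} [AddCommGroup M] [Module S M] {n : ℕ} {μ : Fin n → S}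
    (hμ : ∑ j, μ j = 1) (X : Fin n → M) (b : M) :
    ∑ j, μ j • X j - b = ∑ j, μ j • (X j - b) := by
  simp [smul_sub, Finset.sum_sub_distrib, ← Finset.sum_smul, hμ]

theorem sum_smul_mem {n N : ℕ} {I : Ideal S} (μ : Fin n → S) {V : Fin n → Fin N → S}
    (hV : ∀ j i, V j i ∈ I) (i : Fin N) : (∑ j, μ j • V j) i ∈ I := by
  rw [Finset.sum_apply]
  exact sum_mem fun j _ => I.mul_mem_left _ (hV j i)

variable [Algebra ℚ S]

/-- The affine combination of the points `X j` with weights `μ j` which is determined by the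
symmetric bilinear map `β`. -/
def affComb {n N : ℕ} (β : (Fin N → S) →ₗ[S] (Fin N → S) →ₗ[S] (Fin N → S))
    (μ : Fin (n + 1) → S) (X : Fin (n + 1) → Fin N → S) : Fin N → S :=
  ∑ j, μ j • X j + (2⁻¹ : ℚ) • (β (∑ j, μ j • X j - X 0) (∑ j, μ j • X j - X 0) -
    ∑ j, μ j • β (X j - X 0) (X j - X 0))

theorem affComb_sub_base {n N : ℕ} {μ : Fin (n + 1) → S} (hμ : ∑ j, μ j = 1)
    (β : (Fin N → S) →ₗ[S] (Fin N → S) →ₗ[S] (Fin N → S))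
    (X : Fin (n + 1) → Fin N → S) :
    affComb β μ X - X 0 = ∑ j, μ j • (X j - X 0) + (2⁻¹ : ℚ) •
      (β (∑ j, μ j • (X j - X 0)) (∑ j, μ j • (X j - X 0)) -
        ∑ j, μ j • β (X j - X 0) (X j - X 0)) := by
  rw [affComb, add_sub_right_comm, sum_smul_sub_base hμ]

theorem rat_smul_mem {I : Ideal S} (q : ℚ) {a : S} (ha : a ∈ I) : q • a ∈ I := by
  rw [Algebra.smul_def]
  exact I.mul_mem_left _ ha

/-- The quadratic correction in an affine combination lies in `I ^ 2`. -/
theorem correction_mem {n N M : ℕ} {I : Ideal S}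
    (β : (Fin N → S) →ₗ[S] (Fin N → S) →ₗ[S] (Fin M → S))
    (μ : Fin n → S) {V : Fin n → Fin N → S} (hV : ∀ j i, V j i ∈ I) (i : Fin M) :
    ((2⁻¹ : ℚ) • (β (∑ j, μ j • V j) (∑ j, μ j • V j) - ∑ j, μ j • β (V j) (V j))) i ∈ I * I := by
  refine rat_smul_mem _ (sub_mem ?_ ?_)
  · exact bilinear_apply_mem_mul β (sum_smul_mem μ hV) (sum_smul_mem μ hV) i
  · exact sum_smul_mem μ (fun j i => bilinear_apply_mem_mul β (hV j) (hV j) i) i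

theorem affComb_sub_mem {n N : ℕ} {I : Ideal S} {μ : Fin (n + 1) → S} (hμ : ∑ j, μ j = 1)
    (β : (Fin N → S) →ₗ[S] (Fin N → S) →ₗ[S] (Fin N → S))
    {X : Fin (n + 1) → Fin N → S} (hX : ∀ j i, X j i - X 0 i ∈ I) (i : Fin N) :
    affComb β μ X i - X 0 i ∈ I := by
  have h := congrFun (affComb_sub_base hμ β X) i
  rw [Pi.sub_apply] at h
  rw [h]
  exact add_mem (sum_smul_mem μ (V := fun j => X j - X 0) hX i)
    (Ideal.mul_le_right (correction_mem β μ (V := fun j => X j - X 0) hX i))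

/-- Affine combinations are invariant under a quadratic change of coordinates `y + A v + B[v]^2`
which transforms `β` into `β'` by the rule for Christoffel symbols. -/
theorem affComb_transform {n N M : ℕ} {I : Ideal S} (hI : I ^ 3 = ⊥) {μ : Fin (n + 1) → S}
    (hμ : ∑ j, μ j = 1)
    (β : (Fin N → S) →ₗ[S] (Fin N → S) →ₗ[S] (Fin N → S))
    (β' : (Fin M → S) →ₗ[S] (Fin M → S) →ₗ[S] (Fin M → S))
    (A : (Fin N → S) →ₗ[S] (Fin M → S))
    (B : (Fin N → S) →ₗ[S] (Fin N → S) →ₗ[S] (Fin M → S))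
    (h : ∀ u v, A (β u v) + (B u v + B v u) = β' (A u) (A v))
    {X : Fin (n + 1) → Fin N → S} (hX : ∀ j i, X j i - X 0 i ∈ I)
    {Y : Fin (n + 1) → Fin M → S} (y : Fin M → S)
    (hY : ∀ j, Y j = y + A (X j - X 0) + B (X j - X 0) (X j - X 0)) :
    affComb β' μ Y =
      y + A (affComb β μ X - X 0) + B (affComb β μ X - X 0) (affComb β μ X - X 0) := by
  have hy : Y 0 = y := by simp [hY]
  set V : Fin (n + 1) → Fin N → S := fun j => X j - X 0 with hVdef
  have hV : ∀ j i, V j i ∈ I := hX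
  have hYV : ∀ j, Y j - Y 0 = A (V j) + B (V j) (V j) := fun j => by
    rw [hy, hY, add_assoc, add_sub_cancel_left]
  have hw : ∀ i, (∑ j, μ j • V j) i ∈ I := sum_smul_mem μ hV
  have hAV : ∀ j i, A (V j) i ∈ I := fun j => linear_apply_mem I A (hV j)
  have hBV : ∀ j i, B (V j) (V j) i ∈ I * I := fun j => bilinear_apply_mem_mul B (hV j) (hV j)
  have hYsum : ∑ j, μ j • (Y j - Y 0) = A (∑ j, μ j • V j) + ∑ j, μ j • B (V j) (V j) := by
    simp only [hYV, smul_add, Finset.sum_add_distrib, map_sum, map_smul]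
  have hYsq : ∀ j, β' (Y j - Y 0) (Y j - Y 0) = β' (A (V j)) (A (V j)) := fun j => by
    rw [hYV, bilinear_sq_add hI β' (hAV j) (hBV j)]
  have hsq : β' (∑ j, μ j • (Y j - Y 0)) (∑ j, μ j • (Y j - Y 0)) =
      β' (A (∑ j, μ j • V j)) (A (∑ j, μ j • V j)) := by
    rw [hYsum, bilinear_sq_add hI β' (linear_apply_mem I A hw) (sum_smul_mem μ hBV)]
  have hc := affComb_sub_base hμ β' Y
  rw [sub_eq_iff_eq_add, hsq] at hc
  simp only [hYsq] at hc
  rw [hc, hYsum, hy, affComb_sub_base hμ β X, bilinear_sq_add hI B hw (correction_mem β μ hV)]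
  change _ = y + A (∑ j, μ j • V j + (2⁻¹ : ℚ) • (β (∑ j, μ j • V j) (∑ j, μ j • V j) -
    ∑ j, μ j • β (V j) (V j))) + B (∑ j, μ j • V j) (∑ j, μ j • V j)
  simp only [← h, map_add, map_rat_smul A, map_sub, smul_add, Finset.sum_add_distrib]
  rw [map_sum A (fun j => μ j • β (V j) (V j))]
  simp only [map_smul A]
  generalize ∑ j, μ j • A (β (V j) (V j)) = a
  generalize ∑ j, μ j • B (V j) (V j) = b
  generalize B (∑ j, μ j • V j) (∑ j, μ j • V j) = c
  generalize A (∑ j, μ j • V j) = e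
  generalize A (β (∑ j, μ j • V j) (∑ j, μ j • V j)) = g
  module

/-- The base point `X 0` in an affine combination can be replaced by any other one. -/
theorem affComb_eq_base {n N : ℕ} {μ : Fin (n + 1) → S} (hμ : ∑ j, μ j = 1)
    (β : (Fin N → S) →ₗ[S] (Fin N → S) →ₗ[S] (Fin N → S))
    (X : Fin (n + 1) → Fin N → S) (b : Fin N → S) :
    affComb β μ X = b + ∑ j, μ j • (X j - b) + (2⁻¹ : ℚ) •
      (β (∑ j, μ j • (X j - b)) (∑ j, μ j • (X j - b)) -
        ∑ j, μ j • β (X j - b) (X j - b)) := by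
  have key : ∀ b : Fin N → S,
      β (∑ j, μ j • X j - b) (∑ j, μ j • X j - b) - ∑ j, μ j • β (X j - b) (X j - b) =
        β (∑ j, μ j • X j) (∑ j, μ j • X j) - ∑ j, μ j • β (X j) (X j) := fun b => by
    simp only [map_sub, LinearMap.sub_apply, smul_sub, Finset.sum_sub_distrib, map_sum, map_smul,
      LinearMap.sum_apply, LinearMap.smul_apply, ← Finset.sum_smul, hμ, one_smul]
    abel
  rw [← sum_smul_sub_base hμ, add_sub_cancel, key b, affComb, key (X 0)]

/-- Associativity of affine combinations of points whose distances lie in an ideal `I` with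
`I ^ 3 = 0`. The bilinear map may change with the base point, provided it does so only modulo
`I`. -/
theorem affComb_assoc {m n N : ℕ} {I : Ideal S} (hI : I ^ 3 = ⊥) {μ : Fin (m + 1) → S}
    {ν : Fin (m + 1) → Fin (n + 1) → S} (hμ : ∑ k, μ k = 1) (hν : ∀ k, ∑ j, ν k j = 1)
    (β β' : (Fin N → S) →ₗ[S] (Fin N → S) →ₗ[S] (Fin N → S))
    (h : ∀ u v : Fin N → S, (∀ i, u i ∈ I) → (∀ i, v i ∈ I) → β' u v = β u v)
    {X : Fin (n + 1) → Fin N → S} (hX : ∀ j i, X j i - X 0 i ∈ I) :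
    affComb β' μ (fun k => affComb β (ν k) X) = affComb β (fun j => ∑ k, μ k * ν k j) X := by
  set Z : Fin (m + 1) → Fin N → S := fun k => affComb β (ν k) X with hZdef
  set V : Fin (n + 1) → Fin N → S := fun j => X j - X 0 with hVdef
  have hV : ∀ j i, V j i ∈ I := hX
  have hZI : ∀ k i, (Z k - Z 0) i ∈ I := fun k i => by
    have := sub_mem (affComb_sub_mem (hν k) β hX i) (affComb_sub_mem (hν 0) β hX i)
    simpa using this
  have hββ' : affComb β' μ Z = affComb β μ Z := by
    simp only [affComb, sum_smul_sub_base hμ]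
    rw [h _ _ (sum_smul_mem μ hZI) (sum_smul_mem μ hZI)]
    simp only [h _ _ (hZI _) (hZI _)]
  have hw : ∀ k i, (∑ j, ν k j • V j) i ∈ I := fun k => sum_smul_mem (ν k) hV
  have hZ : ∀ k, Z k - X 0 = ∑ j, ν k j • V j + (2⁻¹ : ℚ) •
      (β (∑ j, ν k j • V j) (∑ j, ν k j • V j) - ∑ j, ν k j • β (V j) (V j)) :=
    fun k => affComb_sub_base (hν k) β X
  have hZsq : ∀ k, β (Z k - X 0) (Z k - X 0) =
      β (∑ j, ν k j • V j) (∑ j, ν k j • V j) := fun k => by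
    rw [hZ, bilinear_sq_add hI β (hw k) (correction_mem β (ν k) hV)]
  have hcomp : ∀ F : Fin (n + 1) → Fin N → S,
      ∑ k, μ k • ∑ j, ν k j • F j = ∑ j, (∑ k, μ k * ν k j) • F j := fun F => by
    simp only [Finset.smul_sum, Finset.sum_smul, smul_smul]
    exact Finset.sum_comm
  have hsum : ∑ k, μ k • (Z k - X 0) = ∑ j, (∑ k, μ k * ν k j) • V j +
      ∑ k, μ k • ((2⁻¹ : ℚ) •
        (β (∑ j, ν k j • V j) (∑ j, ν k j • V j) - ∑ j, ν k j • β (V j) (V j))) := by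
    simp only [hZ, smul_add, Finset.sum_add_distrib, hcomp]
  rw [hββ', affComb_eq_base hμ β Z (X 0), affComb_eq_base (sum_comp_weights hμ hν) β X (X 0)]
  change _ = X 0 + ∑ j, (∑ k, μ k * ν k j) • V j + (2⁻¹ : ℚ) •
    (β (∑ j, (∑ k, μ k * ν k j) • V j) (∑ j, (∑ k, μ k * ν k j) • V j) -
      ∑ j, (∑ k, μ k * ν k j) • β (V j) (V j))
  simp only [hZsq]
  rw [hsum, bilinear_sq_add hI β (sum_smul_mem _ hV)
    (sum_smul_mem μ fun k => correction_mem β (ν k) hV)]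
  simp only [smul_comm (_ : S) (2⁻¹ : ℚ), ← Finset.smul_sum, smul_sub,
    Finset.sum_sub_distrib, hcomp]
  abel

theorem affComb_single {n N : ℕ} (β : (Fin N → S) →ₗ[S] (Fin N → S) →ₗ[S] (Fin N → S))
    (k : Fin (n + 1)) (X : Fin (n + 1) → Fin N → S) :
    affComb β (Pi.single k 1) X = X k := by
  have h : ∀ F : Fin (n + 1) → Fin N → S, ∑ j, (Pi.single k 1 : Fin (n + 1) → S) j • F j = F k :=
    fun F => by simp [Pi.single_apply, ite_smul]
  simp [affComb, h]

/-- The weights `(-1, 1, 1)` give the polarization of `β`. -/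
theorem affComb_neg_one_one_one {N : ℕ} (β : (Fin N → S) →ₗ[S] (Fin N → S) →ₗ[S] (Fin N → S))
    (hβ : ∀ u v, β u v = β v u) (x u v : Fin N → S) :
    affComb β ![-1, 1, 1] ![x, x + u, x + v] = x + u + v + β u v := by
  rw [affComb_eq_base (by simp [Fin.sum_univ_three]) β _ x]
  rw [Fin.sum_univ_three, Fin.sum_univ_three]
  simp [hβ v u]
  module

end Algebra

variable {C : Type u} [Category.{v} C] {J : GrothendieckTopology C}
  {R : Cᵒᵖ ⥤ CommAlgCat.{w} ℚ} {A : Cᵒᵖ ⥤ Type w}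

/-! ### Restriction of points, scalars and vectors -/

theorem map_id_op {c : C} (P : A.obj (op c)) : A.map (𝟙 c).op P = P := by simp

theorem map_comp_op {c d e : C} (f : d ⟶ c) (g : e ⟶ d) (P : A.obj (op c)) :
    A.map (g ≫ f).op P = A.map g.op (A.map f.op P) := by simp

theorem res_id {c : C} (x : R.obj (op c)) : res R (𝟙 c) x = x := by simp [res]

theorem res_comp {c d e : C} (f : d ⟶ c) (g : e ⟶ d) (x : R.obj (op c)) :
    res R (g ≫ f) x = res R g (res R f x) := by simp [res]

section ResVec

variable {c d e : C} {n : ℕ}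

theorem resVec_id (x : Fin n → R.obj (op c)) : resVec R (𝟙 c) x = x :=
  funext fun i => res_id (x i)

theorem resVec_comp (f : d ⟶ c) (g : e ⟶ d) (x : Fin n → R.obj (op c)) :
    resVec R (g ≫ f) x = resVec R g (resVec R f x) :=
  funext fun i => res_comp f g (x i)

theorem resVec_add (f : d ⟶ c) (x y : Fin n → R.obj (op c)) :
    resVec R f (x + y) = resVec R f x + resVec R f y :=
  funext fun _ => map_add _ _ _

theorem resVec_sub (f : d ⟶ c) (x y : Fin n → R.obj (op c)) :
    resVec R f (x - y) = resVec R f x - resVec R f y :=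
  funext fun _ => map_sub _ _ _

theorem resVec_smul (f : d ⟶ c) (a : R.obj (op c)) (x : Fin n → R.obj (op c)) :
    resVec R f (a • x) = res R f a • resVec R f x :=
  funext fun _ => map_mul _ _ _

theorem resVec_rat_smul (f : d ⟶ c) (q : ℚ) (x : Fin n → R.obj (op c)) :
    resVec R f (q • x) = q • resVec R f x :=
  funext fun _ => map_smul (res R f) _ _

theorem resVec_sum {ι : Type*} (s : Finset ι) (f : d ⟶ c) (x : ι → Fin n → R.obj (op c)) :
    resVec R f (∑ j ∈ s, x j) = ∑ j ∈ s, resVec R f (x j) := by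
  funext i
  simp [resVec, Finset.sum_apply, map_sum]

theorem resVec_single (f : d ⟶ c) (i : Fin n) :
    resVec R f (Pi.single i 1) = Pi.single i 1 := by
  funext j
  by_cases h : j = i
  · subst h; simp [resVec]
  · simp [resVec, h]

theorem resVec_lin {m : ℕ} (f : d ⟶ c) (A : Fin m → Fin n → R.obj (op c))
    (u : Fin m → R.obj (op c)) :
    resVec R f (lin A u) = lin (fun i => resVec R f (A i)) (resVec R f u) := by
  simp only [lin_apply, resVec_sum, resVec_smul]
  rfl

theorem resVec_bil {m : ℕ} (f : d ⟶ c) (G : Fin m → Fin m → Fin n → R.obj (op c))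
    (u v : Fin m → R.obj (op c)) :
    resVec R f (bil G u v) =
      bil (fun i j => resVec R f (G i j)) (resVec R f u) (resVec R f v) := by
  simp only [bil_apply, resVec_sum, resVec_smul]
  rfl

theorem resVec_affComb {m : ℕ} (f : d ⟶ c) (G : Fin n → Fin n → Fin n → R.obj (op c))
    (μ : Fin (m + 1) → R.obj (op c)) (X : Fin (m + 1) → Fin n → R.obj (op c)) :
    resVec R f (affComb (bil G) μ X) =
      affComb (bil fun i j => resVec R f (G i j)) (resVec R f μ) (fun j => resVec R f (X j)) := by
  simp only [affComb, resVec_add, resVec_rat_smul, resVec_sub, resVec_bil, resVec_sum, resVec_smul]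
  rfl

end ResVec

theorem eq_of_cover (hR : IsKockLawvere J R) {c : C} {n : ℕ} {x y : Fin n → R.obj (op c)}
    {S : Sieve c} (hS : S ∈ J c)
    (h : ∀ ⦃d : C⦄ (f : d ⟶ c), S f → resVec R f x = resVec R f y) : x = y :=
  funext fun i => (hR.isSheaf S hS).isSeparatedFor.ext fun _ f hf => congrFun (h f hf) i

theorem resVec_mem_D {k n : ℕ} {c d : C} (f : d ⟶ c) {u : Fin n → R.obj (op c)}
    (hu : u ∈ (D R k n).obj (op c)) : resVec R f u ∈ (D R k n).obj (op d) :=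
  (D R k n).map f.op hu

theorem mem_D_of_mem_ideal {k n : ℕ} {c : C} {I : Ideal (R.obj (op c))} (hI : I ^ (k + 1) = ⊥)
    {u : Fin n → R.obj (op c)} (hu : ∀ i, u i ∈ I) : u ∈ (D R k n).obj (op c) := by
  intro s
  have : ∏ i, u (s i) ∈ I ^ (Finset.univ : Finset (Fin (k + 1))).card := by
    rw [← Finset.prod_const]
    exact Ideal.prod_mem_prod fun i _ => hu (s i)
  rwa [Finset.card_fin, hI] at this

/-! ### The Kock-Lawvere axiom in coordinates -/

/-- A functional relation which is stable under restriction defines a map on `D_k(n)`. -/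
theorem exists_stageMap {F : Cᵒᵖ ⥤ Type w} {k n : ℕ} {c : C}
    (T : ∀ ⦃d : C⦄, (d ⟶ c) → (Fin n → R.obj (op d)) → F.obj (op d) → Prop)
    (hex : ∀ ⦃d : C⦄ (f : d ⟶ c) (u : Fin n → R.obj (op d)), u ∈ (D R k n).obj (op d) →
      ∃ y, T f u y)
    (huniq : ∀ ⦃d : C⦄ (f : d ⟶ c) (u : Fin n → R.obj (op d)) (y y'), u ∈ (D R k n).obj (op d) →
      T f u y → T f u y' → y = y')
    (hmap : ∀ ⦃d e : C⦄ (f : d ⟶ c) (g : e ⟶ d) (u : Fin n → R.obj (op d)) (y),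
      u ∈ (D R k n).obj (op d) → T f u y → T (g ≫ f) (resVec R g u) (F.map g.op y)) :
    ∃ t : StageMap (D R k n).toFunctor F c,
      ∀ ⦃d : C⦄ (f : d ⟶ c) (u : Fin n → R.obj (op d)) (hu : u ∈ (D R k n).obj (op d)),
        T f u (t.app f ⟨u, hu⟩) := by
  refine ⟨⟨fun d f u => (hex f u.1 u.2).choose, fun d e f g u => ?_⟩,
    fun d f u hu => (hex f u hu).choose_spec⟩
  exact huniq _ (resVec R g u.1) _ _ (resVec_mem_D g u.2)
    (hmap f g _ _ u.2 (hex f u.1 u.2).choose_spec)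
    (hex (g ≫ f) (resVec R g u.1) (resVec_mem_D g u.2)).choose_spec

theorem StageMap.app_zero {F : Cᵒᵖ ⥤ Type w} {k n : ℕ} {c d : C}
    (t : StageMap (D R k n).toFunctor F c) (f : d ⟶ c) :
    t.app f (D.zero R k n d) = F.map f.op (t.app (𝟙 c) (D.zero R k n c)) := by
  have h : (D R k n).toFunctor.map f.op (D.zero R k n c) = D.zero R k n d :=
    Subtype.ext (funext fun _ => map_zero (res R f))
  rw [t.naturality, h, Category.comp_id]

/-- The Kock-Lawvere axiom assumes `n ≥ 1`; existence also holds for `n = 0`, where `D_k(0)` is a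
point. -/
theorem exists_polynomial (hR : IsKockLawvere J R) {k n : ℕ} (hk : 1 ≤ k) {c : C}
    (t : StageMap (D R k n).toFunctor (line R) c) :
    ∃ p : MvPolynomial (Fin n) (R.obj (op c)), p.totalDegree ≤ k ∧
      ∀ (d : C) (f : d ⟶ c) (u : Fin n → R.obj (op d)) (hu : u ∈ (D R k n).obj (op d)),
        @Eq (R.obj (op d)) (t.app f ⟨u, hu⟩) (p.eval₂ (res R f).toRingHom u) := by
  rcases Nat.eq_zero_or_pos n with rfl | hn
  · let a : R.obj (op c) := t.app (𝟙 c) (D.zero R k 0 c)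
    refine ⟨MvPolynomial.C a, by simp, fun d f u hu => ?_⟩
    rw [MvPolynomial.eval₂_C]
    refine Eq.trans (congrArg (t.app f) (Subtype.ext ?_)) (t.app_zero f)
    exact funext fun i => i.elim0
  · obtain ⟨p, hp, h⟩ := (hR.kockLawvere k n hk hn c t).exists
    exact ⟨p, hp, fun d f u hu => h d f ⟨u, hu⟩⟩

/-- Maps on `D_k(n)` are continuous with respect to ideals: if the coordinates of `u` lie in `I`
then `t u` and `t 0` agree modulo `I`. -/
theorem stageMap_sub_zero_mem (hR : IsKockLawvere J R) {k n : ℕ} (hk : 1 ≤ k) {c d : C}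
    (t : StageMap (D R k n).toFunctor (line R) c) (f : d ⟶ c) {I : Ideal (R.obj (op d))}
    (u : Fin n → R.obj (op d)) (hu : u ∈ (D R k n).obj (op d)) (hI : ∀ i, u i ∈ I)
    {a b : R.obj (op d)} (ha : t.app f ⟨u, hu⟩ = a) (hb : t.app f (D.zero R k n d) = b) :
    a - b ∈ I := by
  obtain ⟨p, -, hp⟩ := exists_polynomial hR hk t
  rw [← show _ = a from ha, ← show _ = b from hb, hp d f u hu,
    show t.app f (D.zero R k n d) = _ from hp d f 0 (zero_mem_D R k n d),
    ← Ideal.Quotient.eq_zero_iff_mem, map_sub, MvPolynomial.hom_eval₂, MvPolynomial.hom_eval₂,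
    sub_eq_zero]
  congr 1
  funext i
  simp only [Pi.zero_apply, map_zero]
  exact Ideal.Quotient.eq_zero_iff_mem.2 (hI i)

theorem exists_quadratic_eval {S : Type w} [CommRing S] {n : ℕ} (p : MvPolynomial (Fin n) S)
    (hp : p.totalDegree ≤ 2) :
    ∃ (a : S) (b : Fin n → S) (q : Fin n → Fin n → S),
      ∀ {T : Type w} [CommRing T] (f : S →+* T) (u : Fin n → T),
        p.eval₂ f u = f a + ∑ i, u i * f (b i) + ∑ i, u i * ∑ j, u j * f (q i j) := by
  rw [p.as_sum]
  refine Finset.sum_induction _ (fun p : MvPolynomial (Fin n) S =>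
    ∃ (a : S) (b : Fin n → S) (q : Fin n → Fin n → S),
      ∀ {T : Type w} [CommRing T] (f : S →+* T) (u : Fin n → T),
        p.eval₂ f u = f a + ∑ i, u i * f (b i) + ∑ i, u i * ∑ j, u j * f (q i j)) ?_ ?_ ?_
  · rintro p p' ⟨a, b, q, h⟩ ⟨a', b', q', h'⟩
    refine ⟨a + a', b + b', q + q', fun f u => ?_⟩
    simp only [MvPolynomial.eval₂_add, h, h', map_add, Pi.add_apply, mul_add,
      Finset.sum_add_distrib]
    ring
  · exact ⟨0, 0, 0, fun f u => by simp⟩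
  · intro m hm
    have hcard : Multiset.card m.toMultiset ≤ 2 := by
      rw [Finsupp.card_toMultiset]
      exact (MvPolynomial.le_totalDegree hm).trans hp
    obtain ⟨s, rfl⟩ : ∃ s : Multiset (Fin n), m = Multiset.toFinsupp s :=
      ⟨m.toMultiset, by simp⟩
    generalize MvPolynomial.coeff _ p = r
    rw [Multiset.toFinsupp_toMultiset] at hcard
    interval_cases h : Multiset.card s
    · rw [Multiset.card_eq_zero] at h
      subst h
      exact ⟨r, 0, 0, fun f u => by simp⟩
    · obtain ⟨i, rfl⟩ := Multiset.card_eq_one.1 h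
      refine ⟨0, Pi.single i r, 0, fun f u => ?_⟩
      simp [MvPolynomial.eval₂_monomial, Pi.single_apply, apply_ite f, mul_comm]
    · obtain ⟨i, j, rfl⟩ := Multiset.card_eq_two.1 h
      refine ⟨0, 0, Pi.single i (Pi.single j r), fun f u => ?_⟩
      have hin : ∑ l, u l * f ((Pi.single j r : Fin n → S) l) = u j * f r := by
        simp [Pi.single_apply, apply_ite f]
      have hout : ∑ k, u k * ∑ l, u l * f ((Pi.single i (Pi.single j r) : Fin n → Fin n → S) k l) =
          u i * (u j * f r) := by
        rw [← hin]
        refine (Finset.sum_eq_single i (fun k _ hk => ?_) (by simp)).trans (by simp)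
        simp [hk]
      rw [hout, MvPolynomial.eval₂_monomial, Multiset.insert_eq_cons, ← Multiset.singleton_add,
        map_add, Finsupp.prod_add_index' (by simp) (by simp [pow_add])]
      simp
      ring

/-- The component of a vector-valued map. -/
def StageMap.component {F : Cᵒᵖ ⥤ Type w} {m : ℕ} {c : C} (t : StageMap F (affSpace R m) c)
    (k : Fin m) : StageMap F (line R) c where
  app _ f x := t.app f x k
  naturality _ _ f g x := congrFun (t.naturality f g x) k

/-- Every map `D_2(n) → R ^ m` is quadratic. -/
theorem exists_quadratic (hR : IsKockLawvere J R) {n m : ℕ} {c : C}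
    (t : StageMap (D R 2 n).toFunctor (affSpace R m) c) :
    ∃ (y : Fin m → R.obj (op c)) (A : Fin n → Fin m → R.obj (op c))
      (B : Fin n → Fin n → Fin m → R.obj (op c)),
      ∀ ⦃d : C⦄ (f : d ⟶ c) (u : Fin n → R.obj (op d)) (hu : u ∈ (D R 2 n).obj (op d)),
        t.app f ⟨u, hu⟩ = resVec R f y + lin (fun i => resVec R f (A i)) u +
          bil (fun i j => resVec R f (B i j)) u u := by
  choose p hp ht using fun k => exists_polynomial hR one_le_two (t.component k)
  choose a b q h using fun k => exists_quadratic_eval (p k) (hp k)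
  refine ⟨a, fun i k => b k i, fun i j k => q k i j, fun d f u hu => funext fun k => ?_⟩
  refine (ht k d f u hu).trans ?_
  rw [h]
  simp only [lin_apply, bil_apply, Pi.add_apply, Finset.sum_apply, Pi.smul_apply, smul_eq_mul]
  rfl

/-- Every map `D_1(n) → R ^ m` is affine. -/
theorem exists_affine (hR : IsKockLawvere J R) {n m : ℕ} {c : C}
    (t : StageMap (D R 1 n).toFunctor (affSpace R m) c) :
    ∃ (y : Fin m → R.obj (op c)) (A : Fin n → Fin m → R.obj (op c)),
      ∀ ⦃d : C⦄ (f : d ⟶ c) (u : Fin n → R.obj (op d)) (hu : u ∈ (D R 1 n).obj (op d)),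
        t.app f ⟨u, hu⟩ = resVec R f y + lin (fun i => resVec R f (A i)) u := by
  choose p hp ht using fun k => exists_polynomial hR le_rfl (t.component k)
  choose a b q h using fun k => exists_quadratic_eval (p k) ((hp k).trans one_le_two)
  refine ⟨a, fun i k => b k i, fun d f u hu => funext fun k => ?_⟩
  refine (ht k d f u hu).trans ?_
  have hsq : ∀ i j, u i * u j = 0 := fun i j => by simpa using hu ![i, j]
  rw [h]
  simp only [lin_apply, Pi.add_apply, Finset.sum_apply, Pi.smul_apply, smul_eq_mul,
    Finset.mul_sum, ← mul_assoc, hsq, zero_mul, Finset.sum_const_zero, add_zero]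
  rfl

/-- A linear form is determined by its values on `D_1(n)` at all later stages. -/
theorem linear_form_eq_zero (hR : IsKockLawvere J R) {n : ℕ} {c : C} {b : Fin n → R.obj (op c)}
    (h : ∀ ⦃d : C⦄ (f : d ⟶ c) (u : Fin n → R.obj (op d)), u ∈ (D R 1 n).obj (op d) →
      ∑ i, u i * res R f (b i) = 0) :
    b = 0 := by
  funext i
  have hn : 1 ≤ n := i.pos
  let t : StageMap (D R 1 n).toFunctor (line R) c :=
    ⟨fun d _ _ => (0 : R.obj (op d)), fun _ _ _ g _ => map_zero (res R g)⟩
  have hpoly : ∀ (d : C) (f : d ⟶ c) (u : Fin n → R.obj (op d)), u ∈ (D R 1 n).obj (op d) →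
      0 = (∑ i, MvPolynomial.monomial (Finsupp.single i 1) (b i)).eval₂ (res R f).toRingHom u :=
    fun d f u hu => by
      rw [MvPolynomial.eval₂_sum]
      refine (h f u hu).symm.trans (Finset.sum_congr rfl fun j _ => ?_)
      simp [MvPolynomial.eval₂_monomial, mul_comm]
  have hq := (hR.kockLawvere 1 n le_rfl hn c t).unique
    (y₁ := ∑ i, MvPolynomial.monomial (Finsupp.single i 1) (b i)) (y₂ := 0)
    ⟨?_, fun d f x => hpoly d f x.1 x.2⟩
    ⟨by simp, fun d f x =>
      (MvPolynomial.eval₂_zero (res R f).toRingHom (x.1 : Fin n → R.obj (op d))).symm⟩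
  · have hc := congrArg (MvPolynomial.coeff (Finsupp.single i 1)) hq
    simpa [MvPolynomial.coeff_sum, MvPolynomial.coeff_monomial, Finsupp.single_left_inj] using hc
  · refine MvPolynomial.totalDegree_finsetSum_le fun j _ => ?_
    exact (MvPolynomial.totalDegree_monomial_le _ _).trans (by simp)

theorem lin_eq_zero (hR : IsKockLawvere J R) {n m : ℕ} {c : C} {A : Fin n → Fin m → R.obj (op c)}
    (h : ∀ ⦃d : C⦄ (f : d ⟶ c) (u : Fin n → R.obj (op d)), u ∈ (D R 1 n).obj (op d) →
      lin (fun i => resVec R f (A i)) u = 0) : A = 0 := by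
  funext i k
  refine congrFun (linear_form_eq_zero hR (b := fun i => A i k) fun d f u hu => ?_) i
  have := congrFun (h f u hu) k
  simpa [lin_apply, Finset.sum_apply, resVec] using this

/-- A bilinear map is determined by its values on `D_1(n) × D_1(n)` at all later stages. -/
theorem bil_eq_zero (hR : IsKockLawvere J R) {n m : ℕ} {c : C}
    {G : Fin n → Fin n → Fin m → R.obj (op c)}
    (h : ∀ ⦃d : C⦄ (f : d ⟶ c) (u v : Fin n → R.obj (op d)), u ∈ (D R 1 n).obj (op d) →
      v ∈ (D R 1 n).obj (op d) → bil (fun i j => resVec R f (G i j)) u v = 0) : G = 0 := by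
  suffices hs : ∀ j, (fun i => G i j) = 0 from funext fun i => funext fun j => congrFun (hs j) i
  have hv : ∀ ⦃d : C⦄ (f : d ⟶ c) (v : Fin n → R.obj (op d)), v ∈ (D R 1 n).obj (op d) →
      (fun i => ∑ j, v j • resVec R f (G i j)) = 0 := fun d f v hv => by
    refine lin_eq_zero hR fun e g u hu => ?_
    have := h (g ≫ f) u (resVec R g v) hu (resVec_mem_D g hv)
    simp only [lin_apply, bil_apply, resVec_sum, resVec_smul, resVec_comp] at this ⊢
    exact this
  intro j
  funext i
  refine congrFun (lin_eq_zero hR (A := G i) fun d f v hv' => ?_) j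
  exact congrFun (hv f v hv') i

/-! ### Coordinates in a chart -/

/-- The point `P` lies in the chart `φ` and has coordinates `x` there. -/
def Chart.At {c : C} (φ : Chart J R A c) {d : C} (f : d ⟶ c) (P : A.obj (op d))
    (x : Fin φ.dim → R.obj (op d)) : Prop :=
  ∃ h : P ∈ φ.mem f, φ.coord f P h = x

namespace Chart

variable {c : C} {φ : Chart J R A c} {d e : C} {f : d ⟶ c}

theorem at_coord {P : A.obj (op d)} (h : P ∈ φ.mem f) : φ.At f P (φ.coord f P h) := ⟨h, rfl⟩

theorem At.unique {P : A.obj (op d)} {x y} (hx : φ.At f P x) (hy : φ.At f P y) : x = y :=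
  hx.2.symm.trans hy.2

theorem At.inj {P Q : A.obj (op d)} {x} (hP : φ.At f P x) (hQ : φ.At f Q x) : P = Q :=
  φ.coord_injective f P Q hP.1 hQ.1 (hP.2.trans hQ.2.symm)

theorem At.map {P : A.obj (op d)} {x} (h : φ.At f P x) (g : e ⟶ d) :
    φ.At (g ≫ f) (A.map g.op P) (resVec R g x) :=
  ⟨φ.mem_map f g P h.1, (φ.coord_map f g P h.1).trans (congrArg _ h.2)⟩

theorem At.of_cover (hR : IsKockLawvere J R) {P : A.obj (op d)} {x} {S : Sieve d} (hS : S ∈ J d)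
    (h : ∀ ⦃e : C⦄ (g : e ⟶ d), S g → φ.At (g ≫ f) (A.map g.op P) (resVec R g x)) :
    φ.At f P x :=
  have hP : P ∈ φ.mem f := φ.mem_of_cover f P S hS fun _ g hg => (h g hg).1
  ⟨hP, eq_of_cover hR hS fun _ g hg => ((at_coord hP).map g).unique (h g hg)⟩

/-- The image of a chart is stable under infinitesimal translations. -/
theorem At.exists_add {P : A.obj (op d)} {x} (h : φ.At f P x) {k : ℕ} (hk : 1 ≤ k)
    {u : Fin φ.dim → R.obj (op d)} (hu : u ∈ (D R k φ.dim).obj (op d)) :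
    ∃ Q, φ.At f Q (x + u) := by
  rcases Nat.eq_zero_or_pos φ.dim with hn | hn
  · refine ⟨P, ?_⟩
    have : x + u = x := funext fun i => (Fin.cast hn i).elim0
    rwa [this]
  · let t : StageMap (D R k φ.dim).toFunctor (affSpace R φ.dim) d :=
      ⟨fun e g u => (fun v : Fin φ.dim → R.obj (op e) => resVec R g x + v) u.1,
        fun e e' g g' u => by
          refine (resVec_add g' (resVec R g x) u.1).trans ?_
          rw [← resVec_comp]
          rfl⟩
    have h0 : t.app (𝟙 d) (D.zero R k φ.dim d) = x := (add_zero _).trans (resVec_id x)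
    obtain ⟨Q, hQ, hx⟩ := φ.isFormallyOpen_image k φ.dim hk hn d f t ⟨P, h.1, h.2.trans h0.symm⟩
      d (𝟙 d) ⟨u, hu⟩
    have hQ' : φ.At (𝟙 d ≫ f) Q (x + u) := ⟨hQ, hx.trans (congrArg (· + u) (resVec_id x))⟩
    rw [Category.id_comp] at hQ'
    exact ⟨Q, hQ'⟩

/-- A chart is stable under infinitesimal perturbations, in any number of parameters. -/
theorem mem_of_stageMap {k n : ℕ} (hk : 1 ≤ k) (t : StageMap (D R k n).toFunctor A d)
    (h0 : t.app (𝟙 d) (D.zero R k n d) ∈ φ.mem f) (g : e ⟶ d)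
    (u : (D R k n).toFunctor.obj (op e)) : t.app g u ∈ φ.mem (g ≫ f) := by
  rcases Nat.eq_zero_or_pos n with rfl | hn
  · rw [show u = D.zero R k 0 e from Subtype.ext (funext fun i => i.elim0), t.app_zero]
    exact φ.mem_map f g _ h0
  · exact φ.isFormallyOpen k n hk hn d f t h0 e g u

/-- The coordinates of a map `D_k(n) → A` with `t 0` in the chart. -/
theorem exists_coord_stageMap {k n : ℕ} (hk : 1 ≤ k) (t : StageMap (D R k n).toFunctor A d)
    (h0 : t.app (𝟙 d) (D.zero R k n d) ∈ φ.mem f) :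
    ∃ s : StageMap (D R k n).toFunctor (affSpace R φ.dim) d,
      ∀ ⦃e : C⦄ (g : e ⟶ d) (u : (D R k n).toFunctor.obj (op e)),
        φ.At (g ≫ f) (t.app g u) (s.app g u) := by
  refine ⟨⟨fun e g u => φ.coord (g ≫ f) (t.app g u) (mem_of_stageMap hk t h0 g u),
    fun e e' g g' u => ?_⟩, fun e g u => at_coord _⟩
  have h1 := (at_coord (mem_of_stageMap (f := f) hk t h0 g u)).map g'
  rw [t.naturality, ← Category.assoc] at h1
  exact h1.unique (at_coord _)

/-- The chart `φ` restricted to a later stage. -/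
def restrict (φ : Chart J R A c) (f : d ⟶ c) : Chart J R A d where
  mem _ g := φ.mem (g ≫ f)
  mem_map _ _ g h P hP := by
    rw [Category.assoc]
    exact φ.mem_map (g ≫ f) h P hP
  mem_of_cover _ g P S hS h := φ.mem_of_cover (g ≫ f) P S hS fun _ k hk => by
    rw [← Category.assoc]
    exact h k hk
  dim := φ.dim
  coord _ g P hP := φ.coord (g ≫ f) P hP
  coord_map _ _ g h P hP := by
    have h1 := (at_coord hP).map h
    rw [← Category.assoc] at h1
    exact h1.2
  coord_injective _ g P Q hP hQ h := φ.coord_injective (g ≫ f) P Q hP hQ h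
  isFormallyOpen k m hk hm _ g t h0 _ h u := by
    have h1 := φ.isFormallyOpen k m hk hm _ (g ≫ f) t h0 _ h u
    rw [← Category.assoc] at h1
    exact h1
  isFormallyOpen_image k m hk hm _ g t h0 _ h u := by
    have h1 := φ.isFormallyOpen_image k m hk hm _ (g ≫ f) t h0 _ h u
    rw [← Category.assoc] at h1
    exact h1

theorem at_restrict {P : A.obj (op d)} {x} (h : φ.At f P x) :
    (φ.restrict f).At (𝟙 d) P x := by
  rw [← Category.id_comp f] at h
  exact h

/-! ### Transition maps -/

/-- The points `x + u` of the chart `φ`, for `u` in `D_k`, form a map `D_k → A`. -/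
theorem At.exists_translates {P : A.obj (op d)} {x} (h : φ.At f P x) {k : ℕ} (hk : 1 ≤ k) :
    ∃ t : StageMap (D R k φ.dim).toFunctor A d,
      (∀ ⦃e : C⦄ (g : e ⟶ d) (u : Fin φ.dim → R.obj (op e)) (hu : u ∈ (D R k φ.dim).obj (op e)),
        φ.At (g ≫ f) (t.app g ⟨u, hu⟩) (resVec R g x + u)) ∧
      t.app (𝟙 d) (D.zero R k φ.dim d) = P := by
  obtain ⟨t, ht⟩ := exists_stageMap (F := A) (k := k) (n := φ.dim) (c := d)
    (fun e g u Q => φ.At (g ≫ f) Q (resVec R g x + u))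
    (fun e g u hu => (h.map g).exists_add hk hu)
    (fun e g u Q Q' _ hQ hQ' => hQ.inj hQ')
    (fun e e' g g' u Q _ hQ => by
      have := hQ.map g'
      rwa [resVec_add, ← resVec_comp, ← Category.assoc] at this)
  refine ⟨t, ht, At.inj (f := f) ?_ h⟩
  have := ht (𝟙 d) 0 (zero_mem_D R k _ d)
  rwa [add_zero, resVec_id, Category.id_comp] at this

/-- A change of charts, as a map on the infinitesimal neighbourhood `D_k` of a point. -/
theorem exists_transition {c' : C} {ψ : Chart J R A c'} {f' : d ⟶ c'} {P : A.obj (op d)} {x y}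
    (hφ : φ.At f P x) (hψ : ψ.At f' P y) {k : ℕ} (hk : 1 ≤ k) :
    ∃ τ : StageMap (D R k φ.dim).toFunctor (affSpace R ψ.dim) d,
      τ.app (𝟙 d) (D.zero R k φ.dim d) = y ∧
      ∀ ⦃e : C⦄ (g : e ⟶ d) (u : Fin φ.dim → R.obj (op e)) (hu : u ∈ (D R k φ.dim).obj (op e))
        (Q : A.obj (op e)), φ.At (g ≫ f) Q (resVec R g x + u) →
          ψ.At (g ≫ f') Q (τ.app g ⟨u, hu⟩) := by
  obtain ⟨t, ht, ht0⟩ := hφ.exists_translates hk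
  obtain ⟨s, hs⟩ := exists_coord_stageMap (φ := ψ) (f := f') hk t (ht0 ▸ hψ.1)
  refine ⟨s, ?_, fun e g u hu Q hQ => (ht g u hu).inj hQ ▸ hs g ⟨u, hu⟩⟩
  have := hs (𝟙 d) (D.zero R k φ.dim d)
  rw [ht0, Category.id_comp] at this
  exact this.unique hψ

/-- A change of charts is quadratic on second-order neighbourhoods. -/
theorem exists_quadratic_transition (hR : IsKockLawvere J R) {c' : C} {ψ : Chart J R A c'}
    {f' : d ⟶ c'} {P : A.obj (op d)} {x y} (hφ : φ.At f P x) (hψ : ψ.At f' P y) :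
    ∃ (a : Fin φ.dim → Fin ψ.dim → R.obj (op d))
      (b : Fin φ.dim → Fin φ.dim → Fin ψ.dim → R.obj (op d)),
      ∀ ⦃e : C⦄ (g : e ⟶ d) (u : Fin φ.dim → R.obj (op e)), u ∈ (D R 2 φ.dim).obj (op e) →
        ∀ Q : A.obj (op e), φ.At (g ≫ f) Q (resVec R g x + u) →
          ψ.At (g ≫ f') Q (resVec R g y + lin (fun i => resVec R g (a i)) u +
            bil (fun i j => resVec R g (b i j)) u u) := by
  obtain ⟨τ, h0, hτ⟩ := exists_transition hφ hψ one_le_two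
  obtain ⟨y', a, b, h⟩ := exists_quadratic hR τ
  have hy : y' = y := by
    have := h (𝟙 d) 0 (zero_mem_D R 2 _ d)
    rw [map_zero, map_zero, add_zero, add_zero, resVec_id] at this
    exact this.symm.trans h0
  subst hy
  exact ⟨a, b, fun e g u hu Q hQ => h g u hu ▸ hτ g u hu Q hQ⟩

end Chart

/-! ### The tuples of the `k`th-order i-structure in coordinates -/

/-- The ideal generated by the coordinates of the differences `X j - X 0`. -/
def nbrIdeal {S : Type*} [CommRing S] {m n : ℕ} (X : Fin (m + 1) → Fin n → S) : Ideal S :=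
  Ideal.span {a | ∃ j i, a = X j i - X 0 i}

theorem sub_mem_nbrIdeal {S : Type*} [CommRing S] {m n : ℕ} (X : Fin (m + 1) → Fin n → S)
    (j : Fin (m + 1)) (i : Fin n) : X j i - X 0 i ∈ nbrIdeal X :=
  Ideal.subset_span ⟨j, i, rfl⟩

theorem nbrIdeal_le {S : Type*} [CommRing S] {m n : ℕ} {X : Fin (m + 1) → Fin n → S} {I : Ideal S}
    (h : ∀ j i, X j i - X 0 i ∈ I) : nbrIdeal X ≤ I :=
  Ideal.span_le.2 (by rintro _ ⟨j, i, rfl⟩; exact h j i)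

theorem ideal_pow_eq_bot_of_le {S : Type*} [CommRing S] {I I' : Ideal S} {k : ℕ} (h : I ≤ I')
    (h' : I' ^ k = ⊥) : I ^ k = ⊥ :=
  le_bot_iff.1 (h' ▸ Ideal.pow_right_mono h k)

theorem multilinear_eq_zero {S : Type*} [CommRing S] {k n : ℕ} {x : Fin k → Fin n → S}
    (h : ∀ s : Fin k → Fin n, ∏ l, x l (s l) = 0)
    (ψ : MultilinearMap S (fun _ : Fin k => Fin n → S) S) : ψ x = 0 := by
  have hx : x = fun l => ∑ i, x l i • (Pi.single i (1 : S) : Fin n → S) := by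
    funext l
    exact (pi_eq_sum_univ' (x l)).trans (Finset.sum_congr rfl fun i _ => by
      congr 1)
  rw [hx, MultilinearMap.map_sum]
  exact Finset.sum_eq_zero fun s _ => by rw [MultilinearMap.map_smul_univ, h s, zero_smul]

theorem nbrIdeal_pow_eq_bot_iff {S : Type*} [CommRing S] {k m n : ℕ}
    {X : Fin (m + 1) → Fin n → S} :
    nbrIdeal X ^ k = ⊥ ↔
      ∀ (j : Fin k → Fin (m + 1)) (i : Fin k → Fin n), ∏ l, (X (j l) (i l) - X 0 (i l)) = 0 := by
  constructor
  · intro h j i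
    have hp : ∏ l, (X (j l) (i l) - X 0 (i l)) ∈
        nbrIdeal X ^ (Finset.univ : Finset (Fin k)).card := by
      rw [← Finset.prod_const]
      exact Ideal.prod_mem_prod fun l _ => sub_mem_nbrIdeal X (j l) (i l)
    rwa [Finset.card_fin, h] at hp
  · intro h
    rw [nbrIdeal, Ideal.span, Submodule.span_pow, Submodule.span_eq_bot]
    intro a ha
    obtain ⟨s, rfl⟩ := Set.mem_pow.1 ha
    choose j i hji using fun l => (s l).2
    rw [List.prod_ofFn]
    simpa only [hji] using h j i

theorem mem_kthRel_iff {k n m : ℕ} {c : C} {X : Fin (m + 1) → Fin n → R.obj (op c)} :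
    X ∈ kthRel R k n (m + 1) c ↔ nbrIdeal X ^ (k + 1) = ⊥ := by
  constructor
  · intro h
    refine nbrIdeal_pow_eq_bot_iff.2 fun j i => ?_
    by_cases h0 : ∀ l, j l ≠ 0
    · have := (h j (fun _ => 0) h0).2 c (𝟙 c)
        ((MultilinearMap.mkPiAlgebra (R.obj (op c)) (Fin (k + 1)) (R.obj (op c))).compLinearMap
          fun l => LinearMap.proj (i l))
      simpa [resVec_id] using this
    · push Not at h0
      obtain ⟨l, hl⟩ := h0
      exact Finset.prod_eq_zero (Finset.mem_univ l) (by rw [hl, sub_self])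
  · intro h i j _
    have hmem : ∀ l s, (X (i l) - X (j l)) s ∈ nbrIdeal X := fun l s => by
      have := sub_mem (sub_mem_nbrIdeal X (i l) s) (sub_mem_nbrIdeal X (j l) s)
      simpa using this
    refine ⟨fun l => mem_D_of_mem_ideal h (hmem l),
      fun d f ψ => multilinear_eq_zero (fun s => ?_) ψ⟩
    have hp : ∏ l, (X (i l) - X (j l)) (s l) ∈
        nbrIdeal X ^ (Finset.univ : Finset (Fin (k + 1))).card := by
      rw [← Finset.prod_const]
      exact Ideal.prod_mem_prod fun l _ => hmem l (s l)
    rw [Finset.card_fin, h] at hp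
    have := congrArg (res R f) hp
    rwa [map_prod, map_zero] at this

theorem isKthTuple_of_at {k m : ℕ} {c d : C} {φ : Chart J R A c} {f : d ⟶ c}
    {P : Fin (m + 1) → A.obj (op d)} {X : Fin (m + 1) → Fin φ.dim → R.obj (op d)}
    (hP : ∀ j, φ.At f (P j) (X j)) (hX : nbrIdeal X ^ (k + 1) = ⊥) :
    P ∈ IsKthTuple J R A k (m + 1) := by
  refine ⟨⊤, J.top_mem d, fun e g _ => ?_⟩
  have hg := fun j => Chart.at_restrict ((hP j).map g)
  refine ⟨φ.restrict (g ≫ f), fun j => (hg j).1, ?_⟩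
  have hcoord : (fun j => (φ.restrict (g ≫ f)).coord (𝟙 e) (A.map g.op (P j)) (hg j).1) =
      fun j => resVec R g (X j) := funext fun j => (hg j).2
  rw [hcoord]
  intro i j hij
  have h := mem_kthRel_iff.2 hX i j hij
  refine ⟨fun l => ?_, fun e' g' ψ => ?_⟩
  · have := resVec_mem_D g (h.1 l)
    rwa [resVec_sub] at this
  · refine (congrArg ψ (funext fun l => ?_)).trans (h.2 e' (g' ≫ g) ψ)
    rw [resVec_comp, resVec_sub g]
    rfl

/-- If the first point of an i-tuple lies in a chart then so do the others, and the coordinates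
satisfy the relations of the `k`th-order i-structure of `R ^ n`. -/
theorem IsKthTuple.exists_coord (hR : IsKockLawvere J R) {k m : ℕ} (hk : 1 ≤ k) {c d : C}
    {φ : Chart J R A c} {f : d ⟶ c} {P : Fin (m + 1) → A.obj (op d)}
    (hP : P ∈ IsKthTuple J R A k (m + 1)) {x} (hx : φ.At f (P 0) x) :
    ∃ X : Fin (m + 1) → Fin φ.dim → R.obj (op d),
      (∀ j, φ.At f (P j) (X j)) ∧ nbrIdeal X ^ (k + 1) = ⊥ := by
  obtain ⟨S, hS, hloc⟩ := hP
  have key : ∀ ⦃e : C⦄ (g : e ⟶ d), S g → ∃ X : Fin (m + 1) → Fin φ.dim → R.obj (op e),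
      (∀ j, φ.At (g ≫ f) (A.map g.op (P j)) (X j)) ∧ nbrIdeal X ^ (k + 1) = ⊥ := by
    intro e g hg
    obtain ⟨χ, hχ, hrel⟩ := hloc g hg
    set Z := fun j => χ.coord (𝟙 e) (A.map g.op (P j)) (hχ j) with hZ
    have hI := mem_kthRel_iff.1 hrel
    obtain ⟨τ, -, hτ⟩ := Chart.exists_transition (Chart.at_coord (hχ 0)) (hx.map g) hk
    have hD : ∀ j, Z j - Z 0 ∈ (D R k χ.dim).obj (op e) := fun j =>
      mem_D_of_mem_ideal hI (sub_mem_nbrIdeal Z j)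
    have hD0 : ∀ h, τ.app (𝟙 e) ⟨Z 0 - Z 0, h⟩ = τ.app (𝟙 e) (D.zero R k χ.dim e) := fun h =>
      congrArg (τ.app (𝟙 e)) (Subtype.ext (sub_self (Z 0)))
    refine ⟨fun j => τ.app (𝟙 e) ⟨Z j - Z 0, hD j⟩, fun j => ?_, ?_⟩
    · have := hτ (𝟙 e) (Z j - Z 0) (hD j) (A.map g.op (P j)) (by
        rw [resVec_id, Category.id_comp, add_sub_cancel]
        exact Chart.at_coord (hχ j))
      rwa [Category.id_comp] at this
    · refine ideal_pow_eq_bot_of_le (nbrIdeal_le fun j i => ?_) hI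
      exact stageMap_sub_zero_mem hR hk (τ.component i) (𝟙 e) _ (hD j) (sub_mem_nbrIdeal Z j)
        rfl (congrFun (hD0 (hD 0)) i).symm
  have hmem : ∀ j, P j ∈ φ.mem f := fun j => φ.mem_of_cover f (P j) S hS fun e g hg => by
    obtain ⟨X, hX, -⟩ := key g hg
    exact (hX j).1
  refine ⟨fun j => φ.coord f (P j) (hmem j), fun j => Chart.at_coord _,
    nbrIdeal_pow_eq_bot_iff.2 fun j i => (hR.isSheaf S hS).isSeparatedFor.ext fun e g hg => ?_⟩
  obtain ⟨X, hX, hI⟩ := key g hg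
  have hXc : ∀ j, resVec R g (φ.coord f (P j) (hmem j)) = X j := fun j =>
    ((Chart.at_coord (hmem j)).map g).unique (hX j)
  change res R g _ = res R g 0
  rw [map_prod, map_zero, ← nbrIdeal_pow_eq_bot_iff.1 hI j i]
  refine Finset.prod_congr rfl fun l _ => ?_
  rw [map_sub, ← hXc, ← hXc]
  rfl

/-! ### Linear and bilinear maps are determined on `D_1` -/

theorem lin_ext (hR : IsKockLawvere J R) {n m : ℕ} {c : C} {a b : Fin n → Fin m → R.obj (op c)}
    (h : ∀ ⦃d : C⦄ (f : d ⟶ c) (u : Fin n → R.obj (op d)), u ∈ (D R 1 n).obj (op d) →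
      lin (fun i => resVec R f (a i)) u = lin (fun i => resVec R f (b i)) u) : a = b := by
  refine sub_eq_zero.1 (lin_eq_zero hR fun d f u hu => ?_)
  have := sub_eq_zero.2 (h f u hu)
  simpa only [lin_apply, Pi.sub_apply, resVec_sub, smul_sub, Finset.sum_sub_distrib] using this

theorem bil_ext (hR : IsKockLawvere J R) {n m : ℕ} {c : C}
    {G H : Fin n → Fin n → Fin m → R.obj (op c)}
    (h : ∀ ⦃d : C⦄ (f : d ⟶ c) (u v : Fin n → R.obj (op d)), u ∈ (D R 1 n).obj (op d) →
      v ∈ (D R 1 n).obj (op d) → bil (fun i j => resVec R f (G i j)) u v =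
        bil (fun i j => resVec R f (H i j)) u v) : G = H := by
  refine sub_eq_zero.1 (bil_eq_zero hR fun d f u v hu hv => ?_)
  have := sub_eq_zero.2 (h f u v hu hv)
  simpa only [bil_apply, Pi.sub_apply, resVec_sub, smul_sub, Finset.sum_sub_distrib] using this

/-- A bilinear map which is natural in the stage vanishes if it vanishes on `D_1(n) × D_1(n)`. -/
theorem bilinear_eq_zero (hR : IsKockLawvere J R) {n m : ℕ} {c : C}
    (K : (Fin n → R.obj (op c)) →ₗ[R.obj (op c)] (Fin n → R.obj (op c)) →ₗ[R.obj (op c)]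
      (Fin m → R.obj (op c)))
    (h : ∀ ⦃d : C⦄ (f : d ⟶ c),
      ∃ K' : (Fin n → R.obj (op d)) →ₗ[R.obj (op d)] (Fin n → R.obj (op d)) →ₗ[R.obj (op d)]
        (Fin m → R.obj (op d)), (∀ x y, resVec R f (K x y) = K' (resVec R f x) (resVec R f y)) ∧
        ∀ u v : Fin n → R.obj (op d), u ∈ (D R 1 n).obj (op d) → v ∈ (D R 1 n).obj (op d) →
          K' u v = 0) : K = 0 := by
  have hK : (fun i j => K (Pi.single i 1) (Pi.single j 1)) = 0 := by
    refine bil_eq_zero hR fun d f u v hu hv => ?_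
    obtain ⟨K', hK', h0⟩ := h f
    simp only [hK', resVec_single]
    rw [bil_of_bilinear, h0 u v hu hv]
  rw [← bil_of_bilinear K, hK]
  ext
  simp [bil_apply]

/-! ### First-order neighbours in a chart -/

theorem span_range_pow_eq_bot {k n : ℕ} {c : C} {u : Fin n → R.obj (op c)}
    (hu : u ∈ (D R k n).obj (op c)) : Ideal.span (Set.range u) ^ (k + 1) = ⊥ := by
  rw [Ideal.span, Submodule.span_pow, Submodule.span_eq_bot]
  intro a ha
  obtain ⟨s, rfl⟩ := Set.mem_pow.1 ha
  choose i hi using fun l => (s l).2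
  rw [List.prod_ofFn]
  simpa only [hi] using hu i

theorem mem_span_range {S : Type*} [CommRing S] {n : ℕ} (u : Fin n → S) (i : Fin n) :
    u i ∈ Ideal.span (Set.range u) := Ideal.subset_span ⟨i, rfl⟩

/-- Two first-order infinitesimal vectors generate an ideal of cube zero. -/
theorem sup_span_range_pow_eq_bot {n : ℕ} {c : C} {u v : Fin n → R.obj (op c)}
    (hu : u ∈ (D R 1 n).obj (op c)) (hv : v ∈ (D R 1 n).obj (op c)) :
    (Ideal.span (Set.range u) + Ideal.span (Set.range v)) ^ 3 = ⊥ := by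
  have h1 : Ideal.span (Set.range u) ^ 2 = 0 := span_range_pow_eq_bot hu
  have h2 : Ideal.span (Set.range v) ^ 2 = 0 := span_range_pow_eq_bot hv
  generalize Ideal.span (Set.range u) = I at h1
  generalize Ideal.span (Set.range v) = I' at h2
  rw [show (I + I') ^ 3 = I ^ 2 * (I + 3 * I') + I' ^ 2 * (3 * I + I') by ring, h1, h2, zero_mul,
    zero_mul, add_zero]
  rfl

section FirstNbr

variable {c d e : C} {φ : Chart J R A c} {f : d ⟶ c} {P Q S : A.obj (op d)}
  {x u v : Fin φ.dim → R.obj (op d)}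

theorem firstNbr_of_at (hP : φ.At f P x) (hu : u ∈ (D R 1 φ.dim).obj (op d))
    (hQ : φ.At f Q (x + u)) : FirstNbr J R A P Q := by
  refine isKthTuple_of_at (X := ![x, x + u]) (Fin.forall_fin_two.2 ⟨hP, hQ⟩)
    (ideal_pow_eq_bot_of_le (nbrIdeal_le (Fin.forall_fin_two.2 ⟨fun i => ?_, fun i => ?_⟩))
      (span_range_pow_eq_bot hu))
  · simp
  · simpa using mem_span_range u i

theorem FirstNbr.exists_at (hR : IsKockLawvere J R) (h : FirstNbr J R A P Q) (hP : φ.At f P x) :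
    ∃ u : Fin φ.dim → R.obj (op d), u ∈ (D R 1 φ.dim).obj (op d) ∧ φ.At f Q (x + u) := by
  obtain ⟨X, hX, hI⟩ := IsKthTuple.exists_coord hR le_rfl h hP
  have h0 : X 0 = x := (hX 0).unique hP
  refine ⟨X 1 - X 0, mem_D_of_mem_ideal hI (sub_mem_nbrIdeal X 1), ?_⟩
  rw [← h0, add_sub_cancel]
  exact hX 1

theorem second_order_triple_of_at (hP : φ.At f P x) (hu : u ∈ (D R 1 φ.dim).obj (op d))
    (hv : v ∈ (D R 1 φ.dim).obj (op d)) (hQ : φ.At f Q (x + u)) (hS : φ.At f S (x + v)) :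
    ![P, Q, S] ∈ IsKthTuple J R A 2 3 := by
  refine isKthTuple_of_at (φ := φ) (f := f) (m := 2) (X := ![x, x + u, x + v]) (fun j => ?_)
    (ideal_pow_eq_bot_of_le (nbrIdeal_le fun j i => ?_) (sup_span_range_pow_eq_bot hu hv))
  · fin_cases j
    exacts [hP, hQ, hS]
  · fin_cases j
    · simp
    · simpa using Ideal.mem_sup_left (mem_span_range u i)
    · simpa using Ideal.mem_sup_right (mem_span_range v i)

end FirstNbr

/-! ### Christoffel symbols at a point -/

section Christoffel

variable {hA : IsFormalManifold J R A} (L : SymmetricConnection hA)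

theorem SymmetricConnection.app_congr {c : C} {P P' Q Q' S S' : A.obj (op c)} (hP : P = P')
    (hQ : Q = Q') (hS : S = S') {h1 h2 h1' h2'} : L.app P Q S h1 h2 = L.app P' Q' S' h1' h2' := by
  subst hP hQ hS
  rfl

/-- In the chart `φ`, the map `Q ↦ L(P, Q, S)` on the first-order neighbourhood of the point `P`
with coordinates `x` is given by `x + u ↦ y + b u`. -/
def IsPartialCoeff {c d : C} (φ : Chart J R A c) (f : d ⟶ c) (P S : A.obj (op d))
    (x y : Fin φ.dim → R.obj (op d)) (b : Fin φ.dim → Fin φ.dim → R.obj (op d)) : Prop :=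
  ∀ ⦃e : C⦄ (g : e ⟶ d) (u : Fin φ.dim → R.obj (op e)), u ∈ (D R 1 φ.dim).obj (op e) →
    ∀ (Q : A.obj (op e)), φ.At (g ≫ f) Q (resVec R g x + u) →
      ∀ (hQ : FirstNbr J R A (A.map g.op P) Q) (hS : FirstNbr J R A (A.map g.op P) (A.map g.op S)),
        φ.At (g ≫ f) (L.app (A.map g.op P) Q (A.map g.op S) hQ hS)
          (resVec R g y + lin (fun i => resVec R g (b i)) u)

/-- `G` is the array of the Christoffel symbols of `L`, in the chart `φ`, at the point `P` with
coordinates `x`. -/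
def IsCoeff {c d : C} (φ : Chart J R A c) (f : d ⟶ c) (P : A.obj (op d))
    (x : Fin φ.dim → R.obj (op d)) (G : Fin φ.dim → Fin φ.dim → Fin φ.dim → R.obj (op d)) : Prop :=
  ∀ ⦃e : C⦄ (g : e ⟶ d) (u v : Fin φ.dim → R.obj (op e)), u ∈ (D R 1 φ.dim).obj (op e) →
    v ∈ (D R 1 φ.dim).obj (op e) → ∀ (Q S : A.obj (op e)), φ.At (g ≫ f) Q (resVec R g x + u) →
      φ.At (g ≫ f) S (resVec R g x + v) →
      ∀ (hQ : FirstNbr J R A (A.map g.op P) Q) (hS : FirstNbr J R A (A.map g.op P) S),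
        φ.At (g ≫ f) (L.app (A.map g.op P) Q S hQ hS)
          (resVec R g x + u + v + bil (fun i j => resVec R g (G i j)) u v)

variable {L} {c d e : C} {φ : Chart J R A c} {f : d ⟶ c} {P Q S : A.obj (op d)}
  {x y u v : Fin φ.dim → R.obj (op d)}

theorem IsPartialCoeff.map {b : Fin φ.dim → Fin φ.dim → R.obj (op d)}
    (h : IsPartialCoeff L φ f P S x y b) (g : e ⟶ d) :
    IsPartialCoeff L φ (g ≫ f) (A.map g.op P) (A.map g.op S) (resVec R g x) (resVec R g y)
      (fun i => resVec R g (b i)) := by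
  intro e' g' u hu Q hQ hPQ hPS
  have := h (g' ≫ g) u hu Q (by simpa only [Category.assoc, resVec_comp] using hQ)
    (by simpa only [map_comp_op] using hPQ) (by simpa only [map_comp_op] using hPS)
  simpa only [Category.assoc, resVec_comp, map_comp_op] using this

theorem IsCoeff.map {G : Fin φ.dim → Fin φ.dim → Fin φ.dim → R.obj (op d)}
    (h : IsCoeff L φ f P x G) (g : e ⟶ d) :
    IsCoeff L φ (g ≫ f) (A.map g.op P) (resVec R g x) (fun i j => resVec R g (G i j)) := by
  intro e' g' u v hu hv Q S hQ hS hPQ hPS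
  have := h (g' ≫ g) u v hu hv Q S (by simpa only [Category.assoc, resVec_comp] using hQ)
    (by simpa only [Category.assoc, resVec_comp] using hS)
    (by simpa only [map_comp_op] using hPQ) (by simpa only [map_comp_op] using hPS)
  simpa only [Category.assoc, resVec_comp, map_comp_op] using this

theorem IsCoeff.at_app {G : Fin φ.dim → Fin φ.dim → Fin φ.dim → R.obj (op d)}
    (h : IsCoeff L φ f P x G) (hu : u ∈ (D R 1 φ.dim).obj (op d))
    (hv : v ∈ (D R 1 φ.dim).obj (op d)) (hQ : φ.At f Q (x + u)) (hS : φ.At f S (x + v))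
    (hPQ : FirstNbr J R A P Q) (hPS : FirstNbr J R A P S) :
    φ.At f (L.app P Q S hPQ hPS) (x + u + v + bil G u v) := by
  have := h (𝟙 d) u v hu hv Q S (by simpa only [Category.id_comp, resVec_id] using hQ)
    (by simpa only [Category.id_comp, resVec_id] using hS)
    (by simpa only [map_id_op] using hPQ) (by simpa only [map_id_op] using hPS)
  simpa only [Category.id_comp, resVec_id, map_id_op] using this

theorem IsPartialCoeff.unique (hR : IsKockLawvere J R) (hP : φ.At f P x)
    (hv : v ∈ (D R 1 φ.dim).obj (op d)) (hS : φ.At f S (x + v))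
    {b b' : Fin φ.dim → Fin φ.dim → R.obj (op d)}
    (h : IsPartialCoeff L φ f P S x y b) (h' : IsPartialCoeff L φ f P S x y b') : b = b' := by
  refine lin_ext hR fun e g u hu => ?_
  obtain ⟨Q, hQ⟩ := (hP.map g).exists_add le_rfl hu
  have hPQ := firstNbr_of_at (hP.map g) hu hQ
  have hPS := (firstNbr_of_at hP hv hS).map hA g
  exact add_left_cancel ((h g u hu Q hQ hPQ hPS).unique (h' g u hu Q hQ hPQ hPS))

/-- For fixed `S`, the map `Q ↦ L(P, Q, S)` takes its values in the chart, because it sends `P` to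
`S` and charts are formally open; so it is affine in coordinates. -/
theorem exists_isPartialCoeff (hR : IsKockLawvere J R) (L : SymmetricConnection hA)
    (hP : φ.At f P x) (hv : v ∈ (D R 1 φ.dim).obj (op d)) (hS : φ.At f S (x + v)) :
    ∃ b, IsPartialCoeff L φ f P S x (x + v) b := by
  obtain ⟨t, ht, ht0⟩ := hP.exists_translates le_rfl
  have hPS := firstNbr_of_at hP hv hS
  let s : StageMap (D R 1 φ.dim).toFunctor A d :=
    ⟨fun e g u => L.app (A.map g.op P) (t.app g u) (A.map g.op S)
        (firstNbr_of_at (hP.map g) u.2 (ht g u.1 u.2)) (hPS.map hA g),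
      fun e e' g g' u => by
        rw [L.app_map]
        exact L.app_congr (map_comp_op _ _ _).symm (t.naturality _ _ _) (map_comp_op _ _ _).symm⟩
  have hs0 : s.app (𝟙 d) (D.zero R 1 φ.dim d) = S :=
    (L.app_congr (map_id_op P) (ht0.trans rfl) (map_id_op S)).trans
      (L.app_left P S (firstNbr_of_at hP (zero_mem_D R 1 _ d) (by rwa [add_zero])) hPS)
  obtain ⟨r, hr⟩ := Chart.exists_coord_stageMap (φ := φ) (f := f) le_rfl s (hs0 ▸ hS.1)
  obtain ⟨y, b, h⟩ := exists_affine hR r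
  have hy : y = x + v := by
    have h1 := h (𝟙 d) 0 (zero_mem_D R 1 _ d)
    rw [map_zero, add_zero, resVec_id] at h1
    have h2 := hr (𝟙 d) (D.zero R 1 _ d)
    rw [hs0, Category.id_comp] at h2
    exact h1.symm.trans (h2.unique hS)
  subst hy
  refine ⟨b, fun e g u hu Q hQ hPQ hPS' => ?_⟩
  have h2 := hr g ⟨u, hu⟩
  rw [h g u hu] at h2
  exact (L.app_congr rfl ((ht g u hu).inj hQ) rfl : s.app g ⟨u, hu⟩ = _) ▸ h2

/-- Christoffel symbols exist: `L(P, Q, S)` is affine in `Q` for fixed `S`, and the coefficients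
are affine in `S`; the equations `L(P, Q, P) = Q` and `L(P, P, S) = S` fix the terms of degree at
most one. -/
theorem exists_isCoeff (hR : IsKockLawvere J R) (L : SymmetricConnection hA) (hP : φ.At f P x) :
    ∃ G, IsCoeff L φ f P x G := by
  have key : ∀ i : Fin φ.dim, ∃ (y : Fin φ.dim → R.obj (op d))
      (a : Fin φ.dim → Fin φ.dim → R.obj (op d)),
      ∀ ⦃e : C⦄ (g : e ⟶ d) (v : Fin φ.dim → R.obj (op e)), v ∈ (D R 1 φ.dim).obj (op e) →
        ∀ (S : A.obj (op e)) (b), φ.At (g ≫ f) S (resVec R g x + v) →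
          IsPartialCoeff L φ (g ≫ f) (A.map g.op P) S (resVec R g x) (resVec R g x + v) b →
          b i = resVec R g y + lin (fun i => resVec R g (a i)) v := by
    intro i
    obtain ⟨t, ht⟩ := exists_stageMap (F := affSpace R φ.dim) (k := 1) (n := φ.dim) (c := d)
      (fun e g v w => ∃ (S : A.obj (op e)) (b : _), φ.At (g ≫ f) S (resVec R g x + v) ∧
        IsPartialCoeff L φ (g ≫ f) (A.map g.op P) S (resVec R g x) (resVec R g x + v) b ∧
        b i = w)
      (fun e g v hv => by
        obtain ⟨S, hS⟩ := (hP.map g).exists_add le_rfl hv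
        obtain ⟨b, hb⟩ := exists_isPartialCoeff hR L (hP.map g) hv hS
        exact ⟨b i, S, b, hS, hb, rfl⟩)
      (by
        rintro e g v _ _ hv ⟨S, b, hS, hb, rfl⟩ ⟨S', b', hS', hb', rfl⟩
        obtain rfl := hS.inj hS'
        rw [hb.unique hR (hP.map g) hv hS hb'])
      (by
        rintro e e' g g' v _ hv ⟨S, b, hS, hb, rfl⟩
        refine ⟨A.map g'.op S, fun i => resVec R g' (b i), ?_, ?_, rfl⟩
        · simpa only [Category.assoc, resVec_comp, resVec_add] using hS.map g'
        · simpa only [Category.assoc, resVec_comp, resVec_add, map_comp_op] using hb.map g')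
    obtain ⟨y, a, h⟩ := exists_affine hR t
    refine ⟨y, a, fun e g v hv S b hS hb => ?_⟩
    obtain ⟨S', b', hS', hb', h1⟩ := ht g v hv
    obtain rfl := hS.inj hS'
    rw [hb.unique hR (hP.map g) hv hS hb', h1, h g v hv]
  choose y G hG using key
  -- `main` is the formula with a linear term `lin y` which is then seen to be the identity.
  have main : ∀ ⦃e : C⦄ (g : e ⟶ d) (u v : Fin φ.dim → R.obj (op e)),
      u ∈ (D R 1 φ.dim).obj (op e) → v ∈ (D R 1 φ.dim).obj (op e) →
      ∀ (Q S : A.obj (op e)), φ.At (g ≫ f) Q (resVec R g x + u) →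
      φ.At (g ≫ f) S (resVec R g x + v) →
      ∀ (hQ : FirstNbr J R A (A.map g.op P) Q) (hS : FirstNbr J R A (A.map g.op P) S),
        φ.At (g ≫ f) (L.app (A.map g.op P) Q S hQ hS) (resVec R g x + v +
          (lin (fun i => resVec R g (y i)) u + bil (fun i j => resVec R g (G i j)) u v)) := by
    intro e g u v hu hv Q S hQ hS hPQ hPS
    obtain ⟨b, hb⟩ := exists_isPartialCoeff hR L (hP.map g) hv hS
    have h1 := hb (𝟙 e) u hu Q (by simpa only [Category.id_comp, resVec_id] using hQ)
      (by simpa only [map_id_op] using hPQ) (by simpa only [map_id_op] using hPS)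
    simp only [Category.id_comp, resVec_id, map_id_op] at h1
    have h2 : lin b u = lin (fun i => resVec R g (y i)) u +
        bil (fun i j => resVec R g (G i j)) u v := by
      simp only [lin_apply, bil_apply, ← Finset.sum_add_distrib, ← smul_add]
      exact Finset.sum_congr rfl fun i _ => by rw [hG i g v hv S b hS hb, lin_apply]
    rwa [h2] at h1
  refine ⟨G, fun e g u v hu hv Q S hQ hS hPQ hPS => ?_⟩
  have hPP : FirstNbr J R A (A.map g.op P) (A.map g.op P) :=
    firstNbr_of_at (hP.map g) (zero_mem_D R 1 _ e) (by rw [add_zero]; exact hP.map g)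
  have h0 := main g u 0 hu (zero_mem_D R 1 _ e) Q (A.map g.op P) hQ
    (by rw [add_zero]; exact hP.map g) hPQ hPP
  rw [L.app_right, map_zero, add_zero, add_zero] at h0
  have hlin : lin (fun i => resVec R g (y i)) u = u := add_left_cancel (h0.unique hQ)
  have h1 := main g u v hu hv Q S hQ hS hPQ hPS
  rw [hlin] at h1
  convert h1 using 1
  abel

theorem IsCoeff.unique (hR : IsKockLawvere J R) (hP : φ.At f P x)
    {G H : Fin φ.dim → Fin φ.dim → Fin φ.dim → R.obj (op d)}
    (hG : IsCoeff L φ f P x G) (hH : IsCoeff L φ f P x H) : G = H := by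
  refine bil_ext hR fun e g u v hu hv => ?_
  obtain ⟨Q, hQ⟩ := (hP.map g).exists_add le_rfl hu
  obtain ⟨S, hS⟩ := (hP.map g).exists_add le_rfl hv
  have hPQ := firstNbr_of_at (hP.map g) hu hQ
  have hPS := firstNbr_of_at (hP.map g) hv hS
  exact add_left_cancel ((hG g u v hu hv Q S hQ hS hPQ hPS).unique
    (hH g u v hu hv Q S hQ hS hPQ hPS))

theorem IsCoeff.symm (hR : IsKockLawvere J R) (hP : φ.At f P x)
    {G : Fin φ.dim → Fin φ.dim → Fin φ.dim → R.obj (op d)} (hG : IsCoeff L φ f P x G)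
    (i j : Fin φ.dim) : G i j = G j i := by
  refine congrFun (congrFun (hG.unique (H := fun i j => G j i) hR hP ?_) i) j
  intro e g u v hu hv Q S hQ hS hPQ hPS
  rw [bil_swap (fun i j => resVec R g (G i j)), L.symm, add_right_comm (resVec R g x)]
  exact hG g v u hv hu S Q hS hQ hPS hPQ

/-- The transformation law of Christoffel symbols under the change of coordinates
`x + u ↦ y + a u + b[u]^2`. -/
theorem IsCoeff.transform (hR : IsKockLawvere J R) {c' : C} {ψ : Chart J R A c'} {f' : d ⟶ c'}
    {y : Fin ψ.dim → R.obj (op d)} (hφ : φ.At f P x)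
    {G : Fin φ.dim → Fin φ.dim → Fin φ.dim → R.obj (op d)}
    {H : Fin ψ.dim → Fin ψ.dim → Fin ψ.dim → R.obj (op d)}
    (hG : IsCoeff L φ f P x G) (hH : IsCoeff L ψ f' P y H)
    {a : Fin φ.dim → Fin ψ.dim → R.obj (op d)}
    {b : Fin φ.dim → Fin φ.dim → Fin ψ.dim → R.obj (op d)}
    (hab : ∀ ⦃e : C⦄ (g : e ⟶ d) (u : Fin φ.dim → R.obj (op e)),
      u ∈ (D R 2 φ.dim).obj (op e) → ∀ Q : A.obj (op e), φ.At (g ≫ f) Q (resVec R g x + u) →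
        ψ.At (g ≫ f') Q (resVec R g y + lin (fun i => resVec R g (a i)) u +
          bil (fun i j => resVec R g (b i j)) u u)) (u v : Fin φ.dim → R.obj (op d)) :
    lin a (bil G u v) + (bil b u v + bil b v u) = bil H (lin a u) (lin a v) := by
  refine sub_eq_zero.1 (LinearMap.congr_fun₂ (bilinear_eq_zero hR
    ((bil G).compr₂ (lin a) + (bil b + (bil b).flip) - (bil H).compl₁₂ (lin a) (lin a))
    fun e g => ?_) u v)
  set a' := fun i => resVec R g (a i) with ha'
  set b' := fun i j => resVec R g (b i j) with hb'
  set G' := fun i j => resVec R g (G i j) with hG'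
  set H' := fun i j => resVec R g (H i j) with hH'
  refine ⟨(bil G').compr₂ (lin a') + (bil b' + (bil b').flip) -
    (bil H').compl₁₂ (lin a') (lin a'), fun x y => ?_, fun u v hu hv => ?_⟩
  · simp only [LinearMap.sub_apply, LinearMap.add_apply, LinearMap.compr₂_apply,
      LinearMap.flip_apply, LinearMap.compl₁₂_apply, resVec_sub, resVec_add, resVec_lin, resVec_bil,
      ha', hb', hG', hH']
  · obtain ⟨Q, hQ⟩ := (hφ.map g).exists_add le_rfl hu
    obtain ⟨S, hS⟩ := (hφ.map g).exists_add le_rfl hv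
    have hPQ := firstNbr_of_at (hφ.map g) hu hQ
    have hPS := firstNbr_of_at (hφ.map g) hv hS
    -- `b[w]^2 = 0` for `w` in `D_1`, so a first-order neighbour has coordinates `y + a w` in the
    -- chart `ψ`.
    have first : ∀ w : Fin φ.dim → R.obj (op e), w ∈ (D R 1 φ.dim).obj (op e) →
        ∀ T : A.obj (op e), φ.At (g ≫ f) T (resVec R g x + w) →
        lin a' w ∈ (D R 1 ψ.dim).obj (op e) ∧ ψ.At (g ≫ f') T (resVec R g y + lin a' w) := by
      intro w hw T hT
      have hI := span_range_pow_eq_bot hw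
      have hbw : bil b' w w = 0 := funext fun k => by
        have := bilinear_apply_mem_mul (bil b') (mem_span_range w) (mem_span_range w) k
        rwa [← sq, hI] at this
      have hw2 : w ∈ (D R 2 φ.dim).obj (op e) := mem_D_of_mem_ideal
        (by rw [pow_succ, hI, Ideal.bot_mul]) (mem_span_range w)
      have h1 := hab g w hw2 T hT
      rw [hbw, add_zero] at h1
      exact ⟨mem_D_of_mem_ideal hI (linear_apply_mem _ _ (mem_span_range w)), h1⟩
    have hI := sup_span_range_pow_eq_bot hu hv
    set I := Ideal.span (Set.range u) + Ideal.span (Set.range v) with hIdef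
    have huI : ∀ i, u i ∈ I := fun i => Ideal.mem_sup_left (mem_span_range u i)
    have hvI : ∀ i, v i ∈ I := fun i => Ideal.mem_sup_right (mem_span_range v i)
    have huvI : ∀ i, (u + v) i ∈ I := fun i => add_mem (huI i) (hvI i)
    have hGI := bilinear_apply_mem_mul (bil G') huI hvI
    have h1 := hG g u v hu hv Q S hQ hS hPQ hPS
    rw [add_assoc, add_assoc, ← add_assoc u] at h1
    have h2 := hab g (u + v + bil G' u v) (mem_D_of_mem_ideal hI fun i =>
      add_mem (huvI i) (Ideal.mul_le_right (hGI i))) _ h1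
    rw [bilinear_sq_add hI _ huvI hGI] at h2
    obtain ⟨hu', hQ'⟩ := first u hu Q hQ
    obtain ⟨hv', hS'⟩ := first v hv S hS
    have h3 : resVec R g y + lin a' (u + v + bil G' u v) + bil b' (u + v) (u + v) =
        resVec R g y + lin a' u + lin a' v + bil H' (lin a' u) (lin a' v) :=
      h2.unique (hH g _ _ hu' hv' Q S hQ' hS' hPQ hPS)
    have huu : bil b' u u = 0 := add_left_cancel
      (((hab g u (mem_D_of_mem_ideal hI huI) Q hQ).unique hQ').trans (add_zero _).symm)
    have hvv : bil b' v v = 0 := add_left_cancel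
      (((hab g v (mem_D_of_mem_ideal hI hvI) S hS).unique hS').trans (add_zero _).symm)
    simp only [map_add, LinearMap.add_apply, huu, hvv, zero_add, add_zero] at h3
    simp only [LinearMap.sub_apply, LinearMap.add_apply, LinearMap.compr₂_apply,
      LinearMap.flip_apply, LinearMap.compl₁₂_apply]
    rw [sub_eq_zero]
    refine add_left_cancel (a := resVec R g y + lin a' u + lin a' v) (Eq.trans ?_ h3)
    abel

/-- Christoffel symbols at infinitesimally close points agree on infinitesimal vectors, up to
terms of third order. -/
theorem IsCoeff.bil_eq_of_near (hR : IsKockLawvere J R) (hP : φ.At f P x)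
    {I : Ideal (R.obj (op d))} (hI : I ^ 3 = ⊥) {w : Fin φ.dim → R.obj (op d)}
    (hw : ∀ i, w i ∈ I) (hQ : φ.At f Q (x + w))
    {G H : Fin φ.dim → Fin φ.dim → Fin φ.dim → R.obj (op d)}
    (hG : IsCoeff L φ f P x G) (hH : IsCoeff L φ f Q (x + w) H)
    (hu : ∀ i, u i ∈ I) (hv : ∀ i, v i ∈ I) : bil H u v = bil G u v := by
  have hmem : ∀ i j k, H i j k - G i j k ∈ I := by
    intro i j k
    obtain ⟨t, ht⟩ := exists_stageMap (F := line R) (k := 2) (n := φ.dim) (c := d)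
      (fun e g w r => ∃ (Q : A.obj (op e)) (H : _), φ.At (g ≫ f) Q (resVec R g x + w) ∧
        IsCoeff L φ (g ≫ f) Q (resVec R g x + w) H ∧ H i j k = r)
      (fun e g w hw => by
        obtain ⟨Q, hQ⟩ := (hP.map g).exists_add one_le_two hw
        obtain ⟨H, hH⟩ := exists_isCoeff hR L hQ
        exact ⟨H i j k, Q, H, hQ, hH, rfl⟩)
      (by
        rintro e g w _ _ hw ⟨Q, H, hQ, hH, rfl⟩ ⟨Q', H', hQ', hH', rfl⟩
        obtain rfl := hQ.inj hQ'
        rw [hH.unique hR hQ hH'])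
      (by
        rintro e e' g g' w _ hw ⟨Q, H, hQ, hH, rfl⟩
        refine ⟨A.map g'.op Q, fun i j => resVec R g' (H i j), ?_, ?_, rfl⟩
        · simpa only [Category.assoc, resVec_comp, resVec_add] using hQ.map g'
        · simpa only [Category.assoc, resVec_comp, resVec_add] using hH.map g')
    have hval : ∀ (w : Fin φ.dim → R.obj (op d)) (hw : w ∈ (D R 2 φ.dim).obj (op d))
        (Q : A.obj (op d)) (H), φ.At f Q (x + w) → IsCoeff L φ f Q (x + w) H →
        t.app (𝟙 d) ⟨w, hw⟩ = H i j k := by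
      intro w hw Q H hQ hH
      obtain ⟨Q', H', hQ', hH', h1⟩ := ht (𝟙 d) w hw
      rw [Category.id_comp, resVec_id] at hQ' hH'
      obtain rfl := hQ.inj hQ'
      rw [← h1, hH.unique hR hQ hH']
    refine stageMap_sub_zero_mem hR one_le_two t (𝟙 d) w (mem_D_of_mem_ideal hI hw) hw
      (hval w _ Q H hQ hH) (hval 0 (zero_mem_D R 2 _ d) P G ?_ ?_)
    · rwa [add_zero]
    · rwa [add_zero]
  funext k
  refine sub_eq_zero.1 ?_
  have h1 : bil H u v k - bil G u v k = ∑ i, u i * ∑ j, v j * (H i j k - G i j k) := by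
    simp [bil_apply, Finset.sum_apply, mul_sub, Finset.sum_sub_distrib]
  have h2 : ∑ i, u i * ∑ j, v j * (H i j k - G i j k) ∈ I * (I * I) :=
    sum_mem fun i _ => Ideal.mul_mem_mul (hu i)
      (sum_mem fun j _ => Ideal.mul_mem_mul (hv j) (hmem i j k))
  rw [h1]
  rwa [show I * (I * I) = I ^ 3 by ring, hI] at h2

end Christoffel

/-! ### Affine combinations of second-order tuples -/

section Combination

variable {hA : IsFormalManifold J R A} (L : SymmetricConnection hA)

/-- `Q` is the affine combination of the points `P j` with weights `μ j`: in every chart which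
contains the `P j`, at any later stage, `Q` is given by the formula in the Christoffel symbols. -/
def IsComb {n : ℕ} {c : C} (μ : Fin (n + 1) → R.obj (op c)) (P : Fin (n + 1) → A.obj (op c))
    (Q : A.obj (op c)) : Prop :=
  ∀ ⦃d : C⦄ (f : d ⟶ c) ⦃c' : C⦄ (φ : Chart J R A c') (g : d ⟶ c')
    (X : Fin (n + 1) → Fin φ.dim → R.obj (op d))
    (G : Fin φ.dim → Fin φ.dim → Fin φ.dim → R.obj (op d)),
    (∀ j, φ.At g (A.map f.op (P j)) (X j)) → IsCoeff L φ g (A.map f.op (P 0)) (X 0) G →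
      φ.At g (A.map f.op Q) (affComb (bil G) (resVec R f μ) X)

variable {L}

theorem nbrIdeal_resVec_pow_eq_bot {k m n : ℕ} {c d : C} (f : d ⟶ c)
    {X : Fin (m + 1) → Fin n → R.obj (op c)} (h : nbrIdeal X ^ k = ⊥) :
    nbrIdeal (fun j => resVec R f (X j)) ^ k = ⊥ := by
  refine nbrIdeal_pow_eq_bot_iff.2 fun j i => ?_
  have := congrArg (res R f) (nbrIdeal_pow_eq_bot_iff.1 h j i)
  rw [map_prod, map_zero] at this
  simp only [map_sub] at this
  exact this

/-- The formula for affine combinations does not depend on the chart. -/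
theorem at_affComb_of_at (hR : IsKockLawvere J R) {n : ℕ} {c c' d : C} {φ : Chart J R A c}
    {f : d ⟶ c} {ψ : Chart J R A c'} {f' : d ⟶ c'} {μ : Fin (n + 1) → R.obj (op d)}
    (hμ : ∑ j, μ j = 1) {P : Fin (n + 1) → A.obj (op d)} {Q : A.obj (op d)} {X Y G H}
    (hX : ∀ j, φ.At f (P j) (X j)) (hI : nbrIdeal X ^ 3 = ⊥) (hY : ∀ j, ψ.At f' (P j) (Y j))
    (hG : IsCoeff L φ f (P 0) (X 0) G) (hH : IsCoeff L ψ f' (P 0) (Y 0) H)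
    (hQ : φ.At f Q (affComb (bil G) μ X)) : ψ.At f' Q (affComb (bil H) μ Y) := by
  obtain ⟨a, b, hab⟩ := Chart.exists_quadratic_transition hR (hX 0) (hY 0)
  have hab' : ∀ (Z : Fin φ.dim → R.obj (op d)), (∀ i, Z i - X 0 i ∈ nbrIdeal X) →
      ∀ Q : A.obj (op d), φ.At f Q Z →
        ψ.At f' Q (Y 0 + lin a (Z - X 0) + bil b (Z - X 0) (Z - X 0)) := by
    intro Z hZ Q hQ
    have := hab (𝟙 d) (Z - X 0) (mem_D_of_mem_ideal hI hZ) Q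
      (by rwa [Category.id_comp, resVec_id, add_sub_cancel])
    simpa only [Category.id_comp, resVec_id] using this
  rw [affComb_transform hI hμ (bil G) (bil H) (lin a) (bil b) (hG.transform hR (hX 0) hH hab)
    (sub_mem_nbrIdeal X) (Y 0)
    (fun j => (hY j).unique (hab' (X j) (sub_mem_nbrIdeal X j) (P j) (hX j)))]
  exact hab' _ (affComb_sub_mem hμ (bil G) (sub_mem_nbrIdeal X)) Q hQ

theorem isComb_of_at (hR : IsKockLawvere J R) {n : ℕ} {c d : C} {φ : Chart J R A c}
    {f : d ⟶ c} {μ : Fin (n + 1) → R.obj (op d)}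
    (hμ : ∑ j, μ j = 1) {P : Fin (n + 1) → A.obj (op d)} {Q : A.obj (op d)} {X G}
    (hX : ∀ j, φ.At f (P j) (X j)) (hI : nbrIdeal X ^ 3 = ⊥)
    (hG : IsCoeff L φ f (P 0) (X 0) G) (hQ : φ.At f Q (affComb (bil G) μ X)) :
    IsComb L μ P Q := by
  intro e g c' ψ f' Y H hY hH
  have hQ' := hQ.map g
  rw [resVec_affComb] at hQ'
  exact at_affComb_of_at hR (sum_resVec g hμ) (fun j => (hX j).map g)
    (nbrIdeal_resVec_pow_eq_bot g hI) hY (hG.map g) hH hQ'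

theorem IsComb.map {n : ℕ} {c d : C} {μ : Fin (n + 1) → R.obj (op c)}
    {P : Fin (n + 1) → A.obj (op c)} {Q : A.obj (op c)} (h : IsComb L μ P Q) (f : d ⟶ c) :
    IsComb L (resVec R f μ) (fun j => A.map f.op (P j)) (A.map f.op Q) := by
  intro e g c' ψ f' Y H hY hH
  simp only [← map_comp_op] at hY hH ⊢
  rw [← resVec_comp]
  exact h (g ≫ f) ψ f' Y H hY hH

theorem IsComb.at {n : ℕ} {c d : C} {φ : Chart J R A c} {f : d ⟶ c}
    {μ : Fin (n + 1) → R.obj (op d)} {P : Fin (n + 1) → A.obj (op d)} {Q : A.obj (op d)}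
    (h : IsComb L μ P Q) {X G} (hX : ∀ j, φ.At f (P j) (X j))
    (hG : IsCoeff L φ f (P 0) (X 0) G) : φ.At f Q (affComb (bil G) μ X) := by
  have := h (𝟙 d) φ f X G (by simpa only [map_id_op] using hX)
    (by simpa only [map_id_op] using hG)
  simpa only [map_id_op, resVec_id] using this

theorem IsComb.of_cover (hR : IsKockLawvere J R) {n : ℕ} {c : C}
    {μ : Fin (n + 1) → R.obj (op c)} {P : Fin (n + 1) → A.obj (op c)} {Q : A.obj (op c)}
    {S : Sieve c} (hS : S ∈ J c) (h : ∀ ⦃d : C⦄ (f : d ⟶ c), S f →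
      IsComb L (resVec R f μ) (fun j => A.map f.op (P j)) (A.map f.op Q)) : IsComb L μ P Q := by
  intro d f c' φ g X G hX hG
  refine Chart.At.of_cover hR (J.pullback_stable f hS) fun e k hk => ?_
  have h1 := (h (k ≫ f) hk).at (φ := φ) (f := k ≫ g) (X := fun j => resVec R k (X j))
    (G := fun i j => resVec R k (G i j)) (fun j => by rw [map_comp_op]; exact (hX j).map k)
    (by rw [map_comp_op]; exact hG.map k)
  rwa [map_comp_op, resVec_comp, ← resVec_affComb] at h1

/-- An i-tuple lies, locally, in a chart. -/
theorem exists_local_coord {k n : ℕ} {c : C} {P : Fin (n + 1) → A.obj (op c)}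
    (hP : P ∈ IsKthTuple J R A k (n + 1)) :
    ∃ S ∈ J c, ∀ ⦃d : C⦄ (f : d ⟶ c), S f → ∃ (φ : Chart J R A d)
      (X : Fin (n + 1) → Fin φ.dim → R.obj (op d)),
      (∀ j, φ.At (𝟙 d) (A.map f.op (P j)) (X j)) ∧ nbrIdeal X ^ (k + 1) = ⊥ := by
  obtain ⟨S, hS, h⟩ := hP
  refine ⟨S, hS, fun d f hf => ?_⟩
  obtain ⟨φ, hφ, hr⟩ := h f hf
  exact ⟨φ, _, fun j => Chart.at_coord (hφ j), mem_kthRel_iff.1 hr⟩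

theorem IsComb.unique (hR : IsKockLawvere J R) {n : ℕ} {c : C}
    {μ : Fin (n + 1) → R.obj (op c)} {P : Fin (n + 1) → A.obj (op c)} {Q Q' : A.obj (op c)}
    (hP : P ∈ IsKthTuple J R A 2 (n + 1)) (h : IsComb L μ P Q) (h' : IsComb L μ P Q') :
    Q = Q' := by
  obtain ⟨S, hS, hloc⟩ := exists_local_coord hP
  refine (hA.isSheaf S hS).isSeparatedFor.ext fun d f hf => ?_
  obtain ⟨φ, X, hX, -⟩ := hloc f hf
  obtain ⟨G, hG⟩ := exists_isCoeff hR L (hX 0)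
  exact ((h.map f).at hX hG).inj ((h'.map f).at hX hG)

/-- The combinations formed in local charts agree by uniqueness, so they glue. -/
theorem exists_isComb (hR : IsKockLawvere J R) (L : SymmetricConnection hA) {n : ℕ} {c : C}
    {μ : Fin (n + 1) → R.obj (op c)} {P : Fin (n + 1) → A.obj (op c)} (hμ : ∑ j, μ j = 1)
    (hP : P ∈ IsKthTuple J R A 2 (n + 1)) : ∃ Q, IsComb L μ P Q := by
  obtain ⟨S, hS, hloc⟩ := exists_local_coord hP
  have hQ : ∀ ⦃d : C⦄ (f : d ⟶ c), S f →
      ∃ Q, IsComb L (resVec R f μ) (fun j => A.map f.op (P j)) Q := by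
    intro d f hf
    obtain ⟨φ, X, hX, hI⟩ := hloc f hf
    obtain ⟨G, hG⟩ := exists_isCoeff hR L (hX 0)
    obtain ⟨Q, hQ⟩ := (hX 0).exists_add one_le_two
      (u := affComb (bil G) (resVec R f μ) X - X 0)
      (mem_D_of_mem_ideal hI (affComb_sub_mem (sum_resVec f hμ) (bil G) (sub_mem_nbrIdeal X)))
    rw [add_sub_cancel] at hQ
    exact ⟨Q, isComb_of_at hR (sum_resVec f hμ) hX hI hG hQ⟩
  choose Q hQ using hQ
  let x : Presieve.FamilyOfElements A S.arrows := fun d f hf => Q f hf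
  have hx : x.Compatible := by
    intro d₁ d₂ e g₁ g₂ f₁ f₂ h₁ h₂ hg
    have e₁ := (hQ f₁ h₁).map g₁
    have e₂ := (hQ f₂ h₂).map g₂
    simp only [← map_comp_op, ← resVec_comp, hg] at e₁ e₂
    exact e₁.unique hR ((kthIStructure hA 2).rel_map _ (g₂ ≫ f₂) P hP) e₂
  obtain ⟨q, hq, -⟩ := hA.isSheaf S hS x hx
  refine ⟨q, IsComb.of_cover hR hS fun d f hf => ?_⟩
  rw [hq f hf]
  exact hQ f hf

/-- Affine combinations of a second-order tuple form a second-order tuple. -/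
theorem IsComb.isKthTuple (hR : IsKockLawvere J R) {m n : ℕ} {c : C}
    {ν : Fin m → Fin (n + 1) → R.obj (op c)} {P : Fin (n + 1) → A.obj (op c)}
    {Q : Fin m → A.obj (op c)} (hν : ∀ k, ∑ j, ν k j = 1)
    (hP : P ∈ IsKthTuple J R A 2 (n + 1)) (h : ∀ k, IsComb L (ν k) P (Q k)) :
    Q ∈ IsKthTuple J R A 2 m := by
  obtain _ | m := m
  · exact (kthIStructure hA 2).rel_zero c Q
  obtain ⟨S, hS, hloc⟩ := exists_local_coord hP
  refine (kthIStructure hA 2).rel_of_cover _ Q S hS fun d f hf => ?_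
  obtain ⟨φ, X, hX, hI⟩ := hloc f hf
  obtain ⟨G, hG⟩ := exists_isCoeff hR L (hX 0)
  refine isKthTuple_of_at (fun k => ((h k).map f).at hX hG)
    (ideal_pow_eq_bot_of_le (nbrIdeal_le fun k i => ?_) hI)
  have hmem := fun k => affComb_sub_mem (sum_resVec f (hν k)) (bil G) (sub_mem_nbrIdeal X) i
  have := sub_mem (hmem k) (hmem 0)
  rwa [sub_sub_sub_cancel_right] at this

/-- The formula for a combination of the `Q k` uses Christoffel symbols at `Q 0`, that for the
`P j` uses those at `P 0`; the difference is of third order. -/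
theorem IsComb.assoc (hR : IsKockLawvere J R) {m n : ℕ} {c : C}
    {μ : Fin (m + 1) → R.obj (op c)} {ν : Fin (m + 1) → Fin (n + 1) → R.obj (op c)}
    {P : Fin (n + 1) → A.obj (op c)} {Q : Fin (m + 1) → A.obj (op c)} {T : A.obj (op c)}
    (hμ : ∑ k, μ k = 1) (hν : ∀ k, ∑ j, ν k j = 1) (hP : P ∈ IsKthTuple J R A 2 (n + 1))
    (h : ∀ k, IsComb L (ν k) P (Q k)) (hT : IsComb L μ Q T) :
    IsComb L (fun j => ∑ k, μ k * ν k j) P T := by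
  obtain ⟨S, hS, hloc⟩ := exists_local_coord hP
  refine IsComb.of_cover hR hS fun d f hf => ?_
  obtain ⟨φ, X, hX, hI⟩ := hloc f hf
  obtain ⟨G, hG⟩ := exists_isCoeff hR L (hX 0)
  have hZ := fun k => ((h k).map f).at hX hG
  obtain ⟨G', hG'⟩ := exists_isCoeff hR L (hZ 0)
  have hT' := (hT.map f).at hZ hG'
  have hres : resVec R f (fun j => ∑ k, μ k * ν k j) =
      fun j => ∑ k, resVec R f μ k * resVec R f (ν k) j := by
    funext j
    simp [resVec, map_sum]
  refine isComb_of_at hR (sum_resVec f (sum_comp_weights hμ hν)) hX hI hG ?_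
  rw [hres, ← affComb_assoc hI (sum_resVec f hμ) (fun k => sum_resVec f (hν k)) (bil G) (bil G')
    (fun u v hu hv => ?_) (sub_mem_nbrIdeal X)]
  · exact hT'
  · have e : affComb (bil G) (resVec R f (ν 0)) X =
        X 0 + (affComb (bil G) (resVec R f (ν 0)) X - X 0) := (add_sub_cancel _ _).symm
    have h0 := hZ 0
    rw [e] at h0 hG'
    exact hG.bil_eq_of_near hR (hX 0) hI
      (affComb_sub_mem (sum_resVec f (hν 0)) (bil G) (sub_mem_nbrIdeal X)) h0 hG' hu hv

theorem isComb_single {n : ℕ} {c : C} (k : Fin (n + 1)) (P : Fin (n + 1) → A.obj (op c)) :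
    IsComb L (Pi.single k 1) P (P k) := by
  intro d f c' φ g X G hX hG
  rw [resVec_single, affComb_single]
  exact hX k

/-- The value `L(P, Q, S)` of the connection is the combination `Q + S - P`. -/
theorem isComb_app (hR : IsKockLawvere J R) {c : C} {P Q S : A.obj (op c)}
    (hPQ : FirstNbr J R A P Q) (hPS : FirstNbr J R A P S) :
    IsComb (n := 2) L ![-1, 1, 1] ![P, Q, S] (L.app P Q S hPQ hPS) := by
  intro d f c' φ g X G hX hG
  have hP : φ.At g (A.map f.op P) (X 0) := hX 0
  obtain ⟨u, hu, hQ⟩ := (hPQ.map hA f).exists_at hR hP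
  obtain ⟨v, hv, hS⟩ := (hPS.map hA f).exists_at hR hP
  have hXuv : X = ![X 0, X 0 + u, X 0 + v] := by
    funext j
    fin_cases j
    exacts [rfl, Chart.At.unique (hX 1) hQ, Chart.At.unique (hX 2) hS]
  have hw : resVec R f ![-1, 1, 1] = ![-1, 1, 1] := by
    funext j
    fin_cases j <;> simp [resVec]
  rw [hXuv, hw, affComb_neg_one_one_one (bil G) (fun u v => bil_symm (hG.symm hR hP) u v),
    L.app_map]
  exact hG.at_app hu hv hQ hS _ _

theorem second_order_triple (hR : IsKockLawvere J R) (hA : IsFormalManifold J R A) {c : C}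
    {P Q S : A.obj (op c)} (hPQ : FirstNbr J R A P Q) (hPS : FirstNbr J R A P S) :
    ![P, Q, S] ∈ (kthIStructure hA 2).rel 3 := by
  obtain ⟨T, hT, h⟩ := hA.exists_chart c P
  refine (kthIStructure hA 2).rel_of_cover 3 _ T hT fun d f hf => ?_
  obtain ⟨φ, hφ⟩ := h f hf
  obtain ⟨u, hu, hQ⟩ := (hPQ.map hA f).exists_at hR (Chart.at_coord hφ)
  obtain ⟨v, hv, hS⟩ := (hPS.map hA f).exists_at hR (Chart.at_coord hφ)
  have := second_order_triple_of_at (Chart.at_coord hφ) hu hv hQ hS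
  have e : (fun i => A.map f.op (![P, Q, S] i)) =
      ![A.map f.op P, A.map f.op Q, A.map f.op S] := by
    funext j
    fin_cases j <;> rfl
  rwa [← e] at this

/-- The affine combination of a second-order tuple. -/
noncomputable def combPoint (hR : IsKockLawvere J R) (L : SymmetricConnection hA) {n : ℕ} {c : C}
    (μ : Fin (n + 1) → R.obj (op c)) (P : Fin (n + 1) → A.obj (op c)) (hμ : ∑ j, μ j = 1)
    (hP : P ∈ IsKthTuple J R A 2 (n + 1)) : A.obj (op c) :=
  (exists_isComb hR L hμ hP).choose

theorem isComb_combPoint (hR : IsKockLawvere J R) (L : SymmetricConnection hA) {n : ℕ}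
    {c : C} {μ : Fin (n + 1) → R.obj (op c)} {P : Fin (n + 1) → A.obj (op c)}
    (hμ : ∑ j, μ j = 1) (hP : P ∈ IsKthTuple J R A 2 (n + 1)) :
    IsComb L μ P (combPoint hR L μ P hμ hP) :=
  (exists_isComb hR L hμ hP).choose_spec

/-- The i-affine structure on `A_2` determined by a symmetric affine connection. -/
noncomputable def connectionStructure (hR : IsKockLawvere J R) (L : SymmetricConnection hA) :
    IAffineStructure R (kthIStructure hA 2) where
  comb _ _ μ P hμ hP := combPoint hR L μ P hμ hP
  comb_map _ _ _ f μ P hμ hP :=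
    have hP' := (kthIStructure hA 2).rel_map _ f P hP
    ((isComb_combPoint hR L hμ hP).map f).unique hR hP'
      (isComb_combPoint hR L (sum_resVec f hμ) hP')
  neighbourhood _ _ _ ν P hν hP :=
    IsComb.isKthTuple hR hν hP fun k => isComb_combPoint hR L (hν k) hP
  associativity _ _ _ μ ν P hμ hν hP :=
    have hQ := fun k => isComb_combPoint hR L (hν k) hP
    (IsComb.assoc hR hμ hν hP hQ
      (isComb_combPoint hR L hμ (IsComb.isKthTuple hR hν hP hQ))).unique hR hP
      (isComb_combPoint hR L (sum_comp_weights hμ hν) hP)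
  projection _ _ k P hP :=
    (isComb_combPoint hR L (by simp) hP).unique hR hP (isComb_single k P)

end Combination

/-! ### The field of Christoffel symbols of a chart -/

section Field

variable {hA : IsFormalManifold J R A} {L : SymmetricConnection hA}

theorem exists_christoffelField (hR : IsKockLawvere J R) (L : SymmetricConnection hA) {c : C}
    (φ : Chart J R A c) :
    ∃ Γ : SymBilinField φ, ∀ ⦃d : C⦄ (f : d ⟶ c) (P : A.obj (op d)) (hP : P ∈ φ.mem f),
      ∃ G, IsCoeff L φ f P (φ.coord f P hP) G ∧ Γ.app f P hP = bil G := by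
  choose G hG using fun (d : C) (f : d ⟶ c) (P : A.obj (op d)) (hP : P ∈ φ.mem f) =>
    exists_isCoeff hR L (Chart.at_coord hP)
  refine ⟨⟨fun d f P hP => bil (G d f P hP), fun d f P hP x y => ?_,
    fun d e f g P hP x y => ?_⟩, fun d f P hP => ⟨G d f P hP, hG d f P hP, rfl⟩⟩
  · exact bil_symm ((hG d f P hP).symm hR (Chart.at_coord hP)) x y
  · have h := (hG d f P hP).map g
    rw [← φ.coord_map f g P hP] at h
    rw [resVec_bil, h.unique hR (Chart.at_coord _) (hG e (g ≫ f) _ (φ.mem_map f g P hP))]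

theorem IsChristoffel.of_isCoeff (hR : IsKockLawvere J R) {c : C} {φ : Chart J R A c}
    {Γ : SymBilinField φ}
    (h : ∀ ⦃d : C⦄ (f : d ⟶ c) (P : A.obj (op d)) (hP : P ∈ φ.mem f),
      ∃ G, IsCoeff L φ f P (φ.coord f P hP) G ∧ Γ.app f P hP = bil G) :
    IsChristoffel L φ Γ := by
  intro d f P Q S hPQ hPS hP
  obtain ⟨G, hG, hΓ⟩ := h f P hP
  obtain ⟨u, hu, hQ⟩ := hPQ.exists_at hR (Chart.at_coord hP)
  obtain ⟨v, hv, hS⟩ := hPS.exists_at hR (Chart.at_coord hP)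
  have hL := hG.at_app hu hv hQ hS hPQ hPS
  refine ⟨hQ.1, hS.1, hL.1, ?_⟩
  rw [hL.2, hQ.2, hS.2, hΓ, add_sub_cancel_left, add_sub_cancel_left]
  abel

/-- A field of Christoffel symbols restricts to the Christoffel symbols at each point, whence its
uniqueness. -/
theorem IsChristoffel.isCoeff {c : C} {φ : Chart J R A c} {Γ : SymBilinField φ}
    (h : IsChristoffel L φ Γ) {d : C} (f : d ⟶ c) (P : A.obj (op d)) (hP : P ∈ φ.mem f) :
    IsCoeff L φ f P (φ.coord f P hP)
      (fun i j => Γ.app f P hP (Pi.single i 1) (Pi.single j 1)) := by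
  intro e g u v hu hv Q S hQ hS hPQ hPS
  obtain ⟨hQ', hS', hL, hLc⟩ := h e (g ≫ f) _ Q S hPQ hPS (φ.mem_map f g P hP)
  refine ⟨hL, ?_⟩
  simp only [Γ.app_map, resVec_single]
  rw [bil_of_bilinear, hLc, φ.coord_map f g P hP, hQ.2, hS.2, add_sub_cancel_left,
    add_sub_cancel_left]
  abel

theorem IsChristoffel.unique (hR : IsKockLawvere J R) {c : C} {φ : Chart J R A c}
    {Γ Γ' : SymBilinField φ} (h : IsChristoffel L φ Γ) (h' : IsChristoffel L φ Γ') : Γ = Γ' := by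
  ext1
  funext d f P hP
  rw [← bil_of_bilinear (Γ.app f P hP), ← bil_of_bilinear (Γ'.app f P hP),
    (h.isCoeff f P hP).unique hR (Chart.at_coord hP) (h'.isCoeff f P hP)]

theorem isGivenBy_connectionStructure (hR : IsKockLawvere J R) {c : C} {φ : Chart J R A c}
    {Γ : SymBilinField φ} (h : IsChristoffel L φ Γ) :
    IsGivenBy (connectionStructure hR L) φ Γ := by
  intro n d f μ P hμ hP hφ
  have hα := (isComb_combPoint hR L hμ hP).at (fun j => Chart.at_coord (hφ j))
    (h.isCoeff f (P 0) (hφ 0))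
  rw [bil_of_bilinear] at hα
  exact hα

end Field

end InfAff

theorem mainTheorem1 {C : Type u} [Category.{v} C] (J : GrothendieckTopology C)
    (R : Cᵒᵖ ⥤ CommAlgCat.{w} ℚ) (hR : InfAff.IsKockLawvere J R)
    (A : Cᵒᵖ ⥤ Type w) (hA : InfAff.IsFormalManifold J R A)
    (L : InfAff.SymmetricConnection hA) :
    ∃ α : InfAff.IAffineStructure R (InfAff.kthIStructure hA 2),
      (∀ (c : C) (P Q S : A.obj (op c)) (hPQ : InfAff.FirstNbr J R A P Q)
        (hPS : InfAff.FirstNbr J R A P S),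
        ∃ hPQS : ![P, Q, S] ∈ (InfAff.kthIStructure hA 2).rel 3,
          L.app P Q S hPQ hPS =
            α.comb 2 ![-1, 1, 1] ![P, Q, S] (by simp [Fin.sum_univ_three]) hPQS) ∧
      ∀ (c : C) (φ : InfAff.Chart J R A c),
        ∃ Γ : InfAff.SymBilinField φ, InfAff.IsChristoffel L φ Γ ∧
          (∀ Γ' : InfAff.SymBilinField φ, InfAff.IsChristoffel L φ Γ' → Γ' = Γ) ∧
          InfAff.IsGivenBy α φ Γ := by
  refine ⟨InfAff.connectionStructure hR L, fun c P Q S hPQ hPS => ?_, fun c φ => ?_⟩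
  · have hPQS := InfAff.second_order_triple hR hA hPQ hPS
    exact ⟨hPQS, (InfAff.isComb_app hR hPQ hPS).unique hR hPQS
      (InfAff.isComb_combPoint hR L (by simp [Fin.sum_univ_three]) hPQS)⟩
  · obtain ⟨Γ, hΓ⟩ := InfAff.exists_christoffelField hR L φ
    have h := InfAff.IsChristoffel.of_isCoeff hR hΓ
    exact ⟨Γ, h, fun Γ' h' => h'.unique hR h, InfAff.isGivenBy_connectionStructure hR h⟩
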